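/- Let $d\ge 1$ and let $D\subset\mathbb R^d$ be a domain (nonempty connected open set). Let $\mathrm{BL}(D)=\{u\in L^2_{\rm loc}(D): \partial u/\partial x_i\in L^2(D),\ 1\le i\le d\}$ (distributional derivatives) be the Beppo Levi space, $\mathbf D(u,v)=\int_D\nabla u\cdot\nabla v\,dx$, and $W^{1,2}(D)=\mathrm{BL}(D)\cap L^2(D)$. Let $W^{1,2}_e(D)$ be the extended Dirichlet space of $(\tfrac12\mathbf D,W^{1,2}(D))$, that is, the space of a.e. finite functions $u$ for which there is a $\mathbf D$-Cauchy sequence $(u_n)\subset W^{1,2}(D)$ with $u_n\to u$ a.e. on $D$. Assume that $D\in\mathcal D$, that is, $W^{1,2}(D)\cap C_c(\overline D)$ is dense both in $W^{1,2}(D)$ with its Sobolev norm and in $C_\infty(\overline D)$ (continuous functions on $\overline D$ vanishing at infinity) with the uniform norm. Let $m\in C_b(\overline D)$ with $m(x)>0$ for every $x\in\overline D$, and write $L^2(D;m)=L^2(D;m(x)\,dx)$. Put $(\mathcal E^{(0)},\mathcal F^{(0)})=(\tfrac12\mathbf D,\;W^{1,2}_e(D)\cap L^2(D;m))$ and $(\mathcal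 E^*,\mathcal F^*)=(\tfrac12\mathbf D,\;\mathrm{BL}(D)\cap L^2(D;m))$. Let $\mathcal F^{(0)}_{\rm loc}$ be the set of functions which on every relatively compact open subset of $\overline D$ agree a.e. with an element of $\mathcal F^{(0)}$, let $\varphi^k(t)=((-k)\vee t)\wedge k$, and define $$\mathcal F^{\rm ref}=\Big\{f:D\to\mathbb R:\ f_k:=\varphi^k\circ f\in\mathcal F^{(0)}_{\rm loc}\ \text{for all } k\ge1,\ \ \sup_{k\ge1}\mathbf D(f_k,f_k)<\infty\Big\},\qquad \mathcal F^{\rm ref}_a=\mathcal F^{\rm ref}\cap L^2(D;m),$$ (functions being identified when they are equal a.e.) and $\mathcal E^{\rm ref}(f,g)=\tfrac12\int_D\nabla f\cdot\nabla g\,dx$ for $f,g\in\mathcal F^{\rm ref}$, where $\nabla f:=\nabla f_k$ a.e. on $\{|f|<k\}$, $k\ge 1$. One calls $(\mathcal E^{\rm ref},\mathcal F^{\rm ref})$ the reflected Dirichlet space and $(\mathcal E^{\rm ref},\mathcal F^{\rm ref}_a)$ the active reflected Dirichlet form of $(\mathcal E^{(0)},\mathcal F^{(0)})$. Then $(\mathcal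 E^{(0)},\mathcal F^{(0)})$ and $(\mathcal E^*,\mathcal F^*)$ are Dirichlet forms on $L^2(D;m)$, the active reflected Dirichlet form of $(\mathcal E^{(0)},\mathcal F^{(0)})$ is $(\mathcal E^*,\mathcal F^*)$, i.e. $\mathcal F^{\rm ref}_a=\mathrm{BL}(D)\cap L^2(D;m)$ and $\mathcal E^{\rm ref}=\tfrac12\mathbf D$ there, and the reflected Dirichlet space of $(\mathcal E^{(0)},\mathcal F^{(0)})$ is $\mathrm{BL}(D)$, with $\mathcal E^{\rm ref}=\tfrac12\mathbf D$ on it. -/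

import Mathlib

open MeasureTheory Filter Topology
open scoped ENNReal ContDiff

noncomputable section

namespace ReflectedDirichlet

/-- Euclidean space `ℝ^d`. -/
abbrev E (d : ℕ) := EuclideanSpace ℝ (Fin d)

/-! Functions on a domain `D` are represented by functions `E d → ℝ` of which only the
values on `D`, up to Lebesgue-null sets, matter; all spaces below are stable under changing a
function outside `D` or on a null set. -/

/-- `G` is the distributional gradient of `u` on the open set `D`. -/
structure HasWeakGrad {d : ℕ} (D : Set (E d)) (u : E d → ℝ) (G : E d → E d) : Prop where
  locInt : LocallyIntegrableOn u D volume
  locInt_grad : LocallyIntegrableOn G D volume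
  integral_eq : ∀ φ : E d → ℝ, ContDiff ℝ ∞ φ → HasCompactSupport φ → tsupport φ ⊆ D →
    ∀ i : Fin d, ∫ x in D, u x * fderiv ℝ φ x (EuclideanSpace.single i 1)
      = - ∫ x in D, G x i * φ x

open Classical in
/-- The distributional gradient of `u` on `D` (unique up to a.e. equality on `D`), for functions
that have a locally integrable one; `0` otherwise. -/
def weakGrad {d : ℕ} (D : Set (E d)) (u : E d → ℝ) : E d → E d :=
  if h : ∃ G, HasWeakGrad D u G then h.choose else 0

/-- The space `BL(D)` of Beppo Levi functions: `u ∈ L²_loc(D)` with distributional gradient in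
`L²(D)`. -/
def BL {d : ℕ} (D : Set (E d)) : Set (E d → ℝ) :=
  {u | (∀ K ⊆ D, IsCompact K → MemLp u 2 (volume.restrict K)) ∧
    ∃ G, HasWeakGrad D u G ∧ MemLp G 2 (volume.restrict D)}

/-- The Dirichlet integral `𝐃(u,v) = ∫_D ∇u · ∇v dx`. -/
def dirichletInt {d : ℕ} (D : Set (E d)) (u v : E d → ℝ) : ℝ :=
  ∫ x in D, inner ℝ (weakGrad D u x) (weakGrad D v x)

/-- `𝐃(u,u) ∈ [0,∞]`, for `u` having a distributional gradient. -/
def dirichletEnergy {d : ℕ} (D : Set (E d)) (u : E d → ℝ) : ℝ≥0∞ :=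
  ∫⁻ x in D, ‖weakGrad D u x‖ₑ ^ 2

/-- The Sobolev space `W^{1,2}(D) = BL(D) ∩ L²(D)`. -/
def W12 {d : ℕ} (D : Set (E d)) : Set (E d → ℝ) :=
  {u | u ∈ BL D ∧ MemLp u 2 (volume.restrict D)}

/-- The extended Sobolev space `W^{1,2}_e(D)`, that is, the extended Dirichlet space of
`(½𝐃, W^{1,2}(D))`: a.e. limits of `𝐃`-Cauchy sequences of `W^{1,2}(D)`. -/
def W12e {d : ℕ} (D : Set (E d)) : Set (E d → ℝ) :=
  {u | ∃ w : ℕ → E d → ℝ, (∀ n, w n ∈ W12 D) ∧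
    (∀ ε > 0, ∃ N, ∀ n ≥ N, ∀ p ≥ N, dirichletInt D (w n - w p) (w n - w p) < ε) ∧
    ∀ᵐ x ∂(volume.restrict D), Tendsto (fun n => w n x) atTop (𝓝 (u x))}

/-- `v` restricts to an element of `C_c(D̄)`. -/
def IsCcClosure {d : ℕ} (D : Set (E d)) (v : E d → ℝ) : Prop :=
  ContinuousOn v (closure D) ∧ ∃ K, IsCompact K ∧ ∀ x ∈ closure D \ K, v x = 0

/-- `w` restricts to an element of `C_∞(D̄)`, the continuous functions on `D̄` that vanish at
infinity. -/
def IsCinftyClosure {d : ℕ} (D : Set (E d)) (w : E d → ℝ) : Prop :=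
  ContinuousOn w (closure D) ∧
    ∀ ε > 0, ∃ K, IsCompact K ∧ ∀ x ∈ closure D \ K, |w x| < ε

/-- The class `𝒟` of domains `D ⊆ ℝ^d` (nonempty connected open sets) for which
`(½𝐃, W^{1,2}(D))` is regular on `L²(D̄)`: `W^{1,2}(D) ∩ C_c(D̄)` is dense in `W^{1,2}(D)` for the
Sobolev norm and in `C_∞(D̄)` for the uniform norm. -/
structure IsRegularDomain {d : ℕ} (D : Set (E d)) : Prop where
  isOpen : IsOpen D
  isConnected : IsConnected D
  dense_W12 : ∀ u ∈ W12 D, ∀ ε > 0, ∃ v ∈ W12 D, IsCcClosure D v ∧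
    (∫ x in D, (u x - v x) ^ 2) + dirichletInt D (u - v) (u - v) < ε
  dense_Cinfty : ∀ w, IsCinftyClosure D w → ∀ ε > 0, ∃ v ∈ W12 D, IsCcClosure D v ∧
    ∀ x ∈ closure D, |w x - v x| < ε

/-- The measure `m(dx) = 1_D(x) m(x) dx`. -/
def wMeasure {d : ℕ} (D : Set (E d)) (m : E d → ℝ) : Measure (E d) :=
  (volume.restrict D).withDensity fun x => ENNReal.ofReal (m x)

/-- A form together with its domain. -/
structure Form (α : Type*) where
  dom : Set (α → ℝ)
  form : (α → ℝ) → (α → ℝ) → ℝ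

/-- Two forms coincide: they have the same domain and the same values there. -/
def Form.Same {α : Type*} (A B : Form α) : Prop :=
  A.dom = B.dom ∧ ∀ u ∈ A.dom, ∀ v ∈ A.dom, A.form u v = B.form u v

/-- `A` is a (symmetric) Dirichlet form on `L²(μ)`: a densely defined, nonnegative, symmetric
bilinear form (compatible with `μ`-a.e. equality) that is closed and Markovian. -/
structure IsDirichletForm {α : Type*} [MeasurableSpace α] (μ : Measure α) (A : Form α) :
    Prop where
  memLp : ∀ u ∈ A.dom, MemLp u 2 μ
  ae_mem : ∀ u ∈ A.dom, ∀ v, u =ᵐ[μ] v → v ∈ A.dom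
  ae_form : ∀ u ∈ A.dom, ∀ v, u =ᵐ[μ] v → ∀ w ∈ A.dom, A.form u w = A.form v w
  add_mem : ∀ u ∈ A.dom, ∀ v ∈ A.dom, u + v ∈ A.dom
  smul_mem : ∀ c : ℝ, ∀ u ∈ A.dom, c • u ∈ A.dom
  dense : ∀ u, MemLp u 2 μ → ∀ ε : ℝ≥0∞, 0 < ε → ∃ v ∈ A.dom, eLpNorm (u - v) 2 μ < ε
  form_add : ∀ u ∈ A.dom, ∀ v ∈ A.dom, ∀ w ∈ A.dom,
    A.form (u + v) w = A.form u w + A.form v w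
  form_smul : ∀ c : ℝ, ∀ u ∈ A.dom, ∀ v ∈ A.dom, A.form (c • u) v = c * A.form u v
  symm : ∀ u ∈ A.dom, ∀ v ∈ A.dom, A.form u v = A.form v u
  nonneg : ∀ u ∈ A.dom, 0 ≤ A.form u u
  closed : ∀ w : ℕ → α → ℝ, (∀ n, w n ∈ A.dom) →
    (∀ ε > 0, ∃ N, ∀ n ≥ N, ∀ p ≥ N,
      A.form (w n - w p) (w n - w p) + ∫ x, (w n x - w p x) ^ 2 ∂μ < ε) →
    ∃ u ∈ A.dom, Tendsto
      (fun n => A.form (w n - u) (w n - u) + ∫ x, (w n x - u x) ^ 2 ∂μ) atTop (𝓝 0)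
  markov : ∀ u ∈ A.dom, (fun x => min (max (u x) 0) 1) ∈ A.dom ∧
    A.form (fun x => min (max (u x) 0) 1) (fun x => min (max (u x) 0) 1) ≤ A.form u u

/-- The form `½𝐃` with domain `F`. -/
def halfD {d : ℕ} (D : Set (E d)) (F : Set (E d → ℝ)) : Form (E d) where
  dom := F
  form u v := (1 / 2) * dirichletInt D u v

/-- The time-changed form `(½𝐃, W^{1,2}_e(D) ∩ L²(D;m))`. -/
def timeChangedForm {d : ℕ} (D : Set (E d)) (m : E d → ℝ) : Form (E d) :=
  halfD D {u | u ∈ W12e D ∧ MemLp u 2 (wMeasure D m)}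

/-- The form `(½𝐃, BL(D) ∩ L²(D;m))`. -/
def starForm {d : ℕ} (D : Set (E d)) (m : E d → ℝ) : Form (E d) :=
  halfD D {u | u ∈ BL D ∧ MemLp u 2 (wMeasure D m)}

/-- The local space `F_loc` of a form on `L²(D̄;m)` with domain `F`: functions that on every
relatively compact, relatively open subset of `D̄` agree a.e. with some element of `F`.
(`D̄` carries the measure `1_D(x) m(x) dx`, whose null sets are those of `1_D(x) dx`.) -/
def locSpace {d : ℕ} (D : Set (E d)) (F : Set (E d → ℝ)) : Set (E d → ℝ) :=
  {f | ∀ U : Set (E d), IsOpen U → Bornology.IsBounded U →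
    ∃ g ∈ F, f =ᵐ[volume.restrict (U ∩ D)] g}

/-- The truncation `φ^k ∘ f`, with `φ^k(t) = ((-k) ∨ t) ∧ k`. -/
def trunc {α : Type*} (k : ℕ) (f : α → ℝ) : α → ℝ :=
  fun x => min (max (-(k : ℝ)) (f x)) k

/-- The gradient of a function all of whose truncations have a distributional gradient: it is
the gradient of `φ^k ∘ f` on `{|f| < k}`. (Such an `f` need not be locally integrable a priori.) -/
def truncGrad {d : ℕ} (D : Set (E d)) (f : E d → ℝ) : E d → E d :=
  fun x => weakGrad D (trunc (⌊|f x|⌋₊ + 1) f) x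

/-- The reflected Dirichlet space of a form `(½𝐃, F)` on `L²(D̄;m)`, with its form:
`F^ref = {f : φ^k ∘ f ∈ F_loc for all k ≥ 1, sup_k 𝐃(φ^k ∘ f, φ^k ∘ f) < ∞}` and
`E^ref(f,g) = ½ ∫_D ∇f · ∇g dx`. -/
def reflectedForm {d : ℕ} (D : Set (E d)) (F : Set (E d → ℝ)) : Form (E d) where
  dom := {f | (∀ k : ℕ, 1 ≤ k → trunc k f ∈ locSpace D F) ∧
    (⨆ k : ℕ, ⨆ _ : 1 ≤ k, dirichletEnergy D (trunc k f)) < (⊤ : ℝ≥0∞)}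
  form f g := (1 / 2) * ∫ x in D, inner ℝ (truncGrad D f x) (truncGrad D g x)

/-- The active reflected Dirichlet form of `(½𝐃, F)`: the reflected one restricted to
`F^ref ∩ L²(D;m)`. -/
def activeReflectedForm {d : ℕ} (D : Set (E d)) (m : E d → ℝ) (F : Set (E d → ℝ)) :
    Form (E d) where
  dom := {f | f ∈ (reflectedForm D F).dom ∧ MemLp f 2 (wMeasure D m)}
  form := (reflectedForm D F).form

end ReflectedDirichlet

end

open MeasureTheory Filter Topology
open scoped ENNReal ContDiff

noncomputable section

namespace ReflectedDirichlet

section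

variable {d : ℕ} {D : Set (E d)} {u v : E d → ℝ} {G H : E d → E d}

/-! ### Distributional gradients -/

/-! The reflected space of `(½𝐃, F)` is the same for every `F` with `W12 D ⊆ F ⊆ BL D`, namely `BL
D`, and the time-changed domain lies in this range. Bounded `m` gives `L²(D) ⊆ L²(D;m)`, hence the
lower inclusion. Continuous positive `m` gives `L²(D;m) ⊆ L²_loc(D)`, and an `L²_loc` function that
is the a.e. limit of a `𝐃`-Cauchy sequence is in `BL D` (`mem_W12e_iff`), hence the upper one.

`BL D ⊆ F^ref` (`BL_subset_reflectedForm_dom`): a truncation of `f ∈ BL(D)` has gradient `1_{|f|<k}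
∇f`, so its energy is at most that of `f`. Being bounded, it becomes an element of `W^{1,2}(D)`
after multiplication by a smooth cutoff of `ℝ^d`, even across the boundary of `D`.

`F^ref ⊆ BL D` (`reflectedForm_dom_subset_BL`): the truncations `f_k` have distributional gradients,
glued from local ones, of uniformly bounded energy. The main point is that `f` is in `L²_loc`
(`l2loc_of_trunc`). Since `f` is finite, it is bounded on a subset of positive measure of any small
ball. A Poincaré type inequality bounds the double integral of `|f_k(x) - f_k(y)|²` by the energy,
and averaging over `y` in that subset bounds `∫ |f_k|²` independently of `k`. Weak compactness in
`L²` then provides the gradient of `f` (`hasWeakGrad_of_energy_le_of_dominated`). The forms agree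
because the gradient of a truncation is the gradient of `f` where nothing is cut.

Both Dirichlet forms come from one criterion, `isDirichletForm_halfD`. Closedness combines
completeness of `L²(D;m)` with lower semicontinuity of the energy. For `W^{1,2}_e(D)` it also takes
a diagonal argument (`mem_W12e_of_tendsto`), and the Markov property takes continuity of the unit
contraction in energy (`tendsto_dirichletEnergy_unit_contraction`). -/

lemma inner_single_one (x : E d) (i : Fin d) : inner ℝ x (EuclideanSpace.single i (1 : ℝ)) = x i := by
  simp [EuclideanSpace.inner_single_right]

lemma gradient_apply (f : E d → ℝ) (x : E d) (i : Fin d) :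
    gradient f x i = fderiv ℝ f x (EuclideanSpace.single i 1) := by
  rw [← inner_single_one, inner_gradient_left]

lemma continuous_gradient {f : E d → ℝ} (hf : ContDiff ℝ 1 f) : Continuous (gradient f) :=
  (InnerProductSpace.toDual ℝ (E d)).symm.continuous.comp (hf.continuous_fderiv (by norm_num))

lemma gradient_eq_zero_of_notMem_tsupport {f : E d → ℝ} {x : E d} (hx : x ∉ tsupport f) :
    gradient f x = 0 := by
  have : fderiv ℝ f x = 0 := fderiv_of_notMem_tsupport (𝕜 := ℝ) hx
  simp [gradient, this]

lemma locallyIntegrableOn_apply (hG : LocallyIntegrableOn G D volume) (i : Fin d) :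
    LocallyIntegrableOn (fun x => G x i) D volume := fun x hx => by
  obtain ⟨U, hU, h⟩ := hG x hx
  exact ⟨U, hU, (EuclideanSpace.proj (𝕜 := ℝ) i).integrable_comp h⟩

lemma integrableOn_mul_of_tsupport_subset (hD : IsOpen D) (hu : LocallyIntegrableOn u D volume)
    {ψ : E d → ℝ} (hψ : Continuous ψ) (hc : HasCompactSupport ψ) (hs : tsupport ψ ⊆ D) :
    IntegrableOn (fun x => u x * ψ x) D := by
  have h1 : IntegrableOn u (tsupport ψ) := hu.integrableOn_compact_subset hs hc
  have h2 : IntegrableOn (fun x => u x * ψ x) (tsupport ψ) :=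
    h1.mul_continuousOn hψ.continuousOn hc
  refine h2.of_forall_sdiff_eq_zero hD.measurableSet fun x hx => ?_
  simp [image_eq_zero_of_notMem_tsupport hx.2]

lemma continuous_fderiv_single {φ : E d → ℝ} (hφ : ContDiff ℝ ∞ φ) (i : Fin d) :
    Continuous fun x => fderiv ℝ φ x (EuclideanSpace.single i 1) :=
  (hφ.continuous_fderiv (by simp)).clm_apply continuous_const

lemma tsupport_fderiv_single_subset (φ : E d → ℝ) (i : Fin d) :
    tsupport (fun x => fderiv ℝ φ x (EuclideanSpace.single i 1)) ⊆ tsupport φ :=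
  tsupport_fderiv_apply_subset ℝ _

lemma hasCompactSupport_fderiv_single {φ : E d → ℝ} (hφ : HasCompactSupport φ) (i : Fin d) :
    HasCompactSupport fun x => fderiv ℝ φ x (EuclideanSpace.single i 1) :=
  hφ.fderiv_apply ℝ _

lemma integrableOn_mul_fderiv (hD : IsOpen D) (hu : LocallyIntegrableOn u D volume)
    {φ : E d → ℝ} (hφ : ContDiff ℝ ∞ φ) (hc : HasCompactSupport φ) (hs : tsupport φ ⊆ D)
    (i : Fin d) :
    IntegrableOn (fun x => u x * fderiv ℝ φ x (EuclideanSpace.single i 1)) D :=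
  integrableOn_mul_of_tsupport_subset hD hu (continuous_fderiv_single hφ i)
    (hasCompactSupport_fderiv_single hc i) ((tsupport_fderiv_single_subset φ i).trans hs)

lemma HasWeakGrad.congr (h : HasWeakGrad D u G) (hu : u =ᵐ[volume.restrict D] v)
    (hG : G =ᵐ[volume.restrict D] H) : HasWeakGrad D v H where
  locInt := h.locInt.congr hu
  locInt_grad := h.locInt_grad.congr hG
  integral_eq φ h1 h2 h3 i := by
    have e1 : ∫ x in D, v x * fderiv ℝ φ x (EuclideanSpace.single i 1) =
        ∫ x in D, u x * fderiv ℝ φ x (EuclideanSpace.single i 1) :=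
      integral_congr_ae (by filter_upwards [hu] with x hx; rw [hx])
    have e2 : ∫ x in D, H x i * φ x = ∫ x in D, G x i * φ x :=
      integral_congr_ae (by filter_upwards [hG] with x hx; rw [hx])
    rw [e1, e2, h.integral_eq φ h1 h2 h3 i]

/-- Each component of the difference integrates to zero against all test functions, so it vanishes
a.e. by the fundamental lemma of the calculus of variations. This makes the choice in `weakGrad`
harmless. -/
lemma HasWeakGrad.ae_unique (hD : IsOpen D) (h : HasWeakGrad D u G) (h' : HasWeakGrad D u H) :
    G =ᵐ[volume.restrict D] H := by
  have key : ∀ i : Fin d, ∀ᵐ x ∂(volume : Measure (E d)), x ∈ D → G x i - H x i = 0 := by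
    intro i
    have hG := locallyIntegrableOn_apply h.locInt_grad i
    have hH := locallyIntegrableOn_apply h'.locInt_grad i
    refine hD.ae_eq_zero_of_integral_contDiff_smul_eq_zero (hG.sub hH) fun g g1 g2 g3 => ?_
    rw [← setIntegral_eq_integral_of_forall_compl_eq_zero (s := D)]
    · have e1 := h.integral_eq g g1 g2 g3 i
      have e2 := h'.integral_eq g g1 g2 g3 i
      have : ∫ x in D, (G x i * g x - H x i * g x) = 0 := by
        rw [integral_sub (integrableOn_mul_of_tsupport_subset hD hG g1.continuous g2 g3)
          (integrableOn_mul_of_tsupport_subset hD hH g1.continuous g2 g3)]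
        linarith
      rw [← this]
      congr 1 with x
      simp; ring
    · intro x hx
      rw [image_eq_zero_of_notMem_tsupport (fun h => hx (g3 h)), zero_smul]
  rw [← ae_all_iff] at key
  rw [Filter.EventuallyEq, ae_restrict_iff' hD.measurableSet]
  filter_upwards [key] with x hx hxD
  ext i
  linarith [hx i hxD]

lemma HasWeakGrad.weakGrad (h : HasWeakGrad D u G) : HasWeakGrad D u (weakGrad D u) := by
  have h' : ∃ G, HasWeakGrad D u G := ⟨G, h⟩
  rw [ReflectedDirichlet.weakGrad, dif_pos h']
  exact h'.choose_spec

lemma HasWeakGrad.weakGrad_ae (hD : IsOpen D) (h : HasWeakGrad D u G) :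
    ReflectedDirichlet.weakGrad D u =ᵐ[volume.restrict D] G :=
  h.weakGrad.ae_unique hD h

lemma HasWeakGrad.add (hD : IsOpen D) (h : HasWeakGrad D u G) (h' : HasWeakGrad D v H) :
    HasWeakGrad D (u + v) (G + H) where
  locInt := h.locInt.add h'.locInt
  locInt_grad := h.locInt_grad.add h'.locInt_grad
  integral_eq φ h1 h2 h3 i := by
    simp only [Pi.add_apply, PiLp.add_apply, add_mul]
    rw [integral_add (integrableOn_mul_fderiv hD h.locInt h1 h2 h3 i)
      (integrableOn_mul_fderiv hD h'.locInt h1 h2 h3 i), integral_add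
      (integrableOn_mul_of_tsupport_subset hD (locallyIntegrableOn_apply h.locInt_grad i)
        h1.continuous h2 h3)
      (integrableOn_mul_of_tsupport_subset hD (locallyIntegrableOn_apply h'.locInt_grad i)
        h1.continuous h2 h3), h.integral_eq φ h1 h2 h3 i, h'.integral_eq φ h1 h2 h3 i]
    ring

lemma HasWeakGrad.const_smul (c : ℝ) (h : HasWeakGrad D u G) :
    HasWeakGrad D (c • u) (c • G) where
  locInt := h.locInt.smul c
  locInt_grad := h.locInt_grad.smul c
  integral_eq φ h1 h2 h3 i := by
    simp only [Pi.smul_apply, PiLp.smul_apply, smul_eq_mul, mul_assoc]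
    rw [integral_const_mul, integral_const_mul, h.integral_eq φ h1 h2 h3 i]
    ring

lemma HasWeakGrad.sub (hD : IsOpen D) (h : HasWeakGrad D u G) (h' : HasWeakGrad D v H) :
    HasWeakGrad D (u - v) (G - H) := by
  have := h.add hD (h'.const_smul (-1))
  simpa [sub_eq_add_neg] using this

/-- A `C¹` function has its gradient as distributional gradient. -/
lemma hasWeakGrad_gradient (hD : IsOpen D) {f : E d → ℝ} (hf : ContDiff ℝ 1 f) :
    HasWeakGrad D f (gradient f) where
  locInt := hf.continuous.continuousOn.locallyIntegrableOn hD.measurableSet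
  locInt_grad := (continuous_gradient hf).continuousOn.locallyIntegrableOn hD.measurableSet
  integral_eq φ h1 h2 h3 i := by
    have z : ∀ x ∉ D, φ x = 0 := fun x hx =>
      image_eq_zero_of_notMem_tsupport (fun h => hx (h3 h))
    have z' : ∀ x ∉ D, fderiv ℝ φ x (EuclideanSpace.single i 1) = 0 := fun x hx =>
      image_eq_zero_of_notMem_tsupport
        (f := fun x => fderiv ℝ φ x (EuclideanSpace.single i 1))
        (fun h => hx (h3 (tsupport_fderiv_single_subset φ i h)))
    rw [setIntegral_eq_integral_of_forall_compl_eq_zero (fun x hx => by rw [z' x hx, mul_zero]),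
      setIntegral_eq_integral_of_forall_compl_eq_zero (fun x hx => by rw [z x hx, mul_zero])]
    simp only [gradient_apply]
    have c1 : Continuous fun x => fderiv ℝ f x (EuclideanSpace.single i 1) :=
      (hf.continuous_fderiv (by norm_num)).clm_apply continuous_const
    refine integral_mul_fderiv_eq_neg_fderiv_mul_of_integrable ?_ ?_ ?_
      (fun x _ => (hf.differentiable (by norm_num)).differentiableAt)
      (fun x _ => (h1.differentiable (by simp)).differentiableAt)
    · exact (c1.mul h1.continuous).integrable_of_hasCompactSupport h2.mul_left
    · exact (hf.continuous.mul (continuous_fderiv_single h1 i)).integrable_of_hasCompactSupport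
        (hasCompactSupport_fderiv_single h2 i).mul_left
    · exact (hf.continuous.mul h1.continuous).integrable_of_hasCompactSupport h2.mul_left

/-- Product rule with a smooth function `χ`, on a set `D'` in place of `D` as soon as `χ φ` is a test
function on `D` for all test functions `φ` on `D'`. -/
lemma HasWeakGrad.smooth_mul_aux {D' : Set (E d)} (hD : IsOpen D)
    (h : HasWeakGrad D u G) {χ : E d → ℝ} (hχ : ContDiff ℝ ∞ χ)
    (hs : ∀ φ : E d → ℝ, tsupport φ ⊆ D' → tsupport (fun x => χ x * φ x) ⊆ D)
    (hz : ∀ x ∉ D, x ∈ D' → χ x = 0 ∧ gradient χ x = 0) (hD' : IsOpen D') (hDD : D ⊆ D')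
    (l1 : LocallyIntegrableOn (fun x => χ x * u x) D' volume)
    (l2 : LocallyIntegrableOn (fun x => χ x • G x + u x • gradient χ x) D' volume) :
    HasWeakGrad D' (fun x => χ x * u x) (fun x => χ x • G x + u x • gradient χ x) where
  locInt := l1
  locInt_grad := l2
  integral_eq φ h1 h2 h3 i := by
    have hχφ : ContDiff ℝ ∞ (fun x => χ x * φ x) := hχ.mul h1
    have hcχφ : HasCompactSupport (fun x => χ x * φ x) := h2.mul_left
    have key := h.integral_eq _ hχφ hcχφ (hs φ h3) i
    have hfd : ∀ x, fderiv ℝ (fun x => χ x * φ x) x (EuclideanSpace.single i 1) =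
        χ x * fderiv ℝ φ x (EuclideanSpace.single i 1) + gradient χ x i * φ x := fun x => by
      rw [fderiv_fun_mul (hχ.differentiable (by simp)).differentiableAt
        (h1.differentiable (by simp)).differentiableAt, gradient_apply]
      simp
      ring
    have hgc : Continuous fun x => gradient χ x i := by
      simp only [gradient_apply]; exact continuous_fderiv_single hχ i
    have e1 : ∫ x in D', χ x * u x * fderiv ℝ φ x (EuclideanSpace.single i 1) =
        ∫ x in D, u x * (χ x * fderiv ℝ φ x (EuclideanSpace.single i 1)) := by
      rw [setIntegral_eq_of_subset_of_forall_sdiff_eq_zero hD'.measurableSet hDD]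
      · congr 1 with x; ring
      · intro x hx; simp [(hz x hx.2 hx.1).1]
    have e2 : ∫ x in D', (χ x • G x + u x • gradient χ x) i * φ x =
        ∫ x in D, (G x i * (χ x * φ x) + u x * (gradient χ x i * φ x)) := by
      rw [setIntegral_eq_of_subset_of_forall_sdiff_eq_zero hD'.measurableSet hDD]
      · congr 1 with x; simp; ring
      · intro x hx; simp [(hz x hx.2 hx.1).1, (hz x hx.2 hx.1).2]
    rw [e1, e2]
    -- By the product rule this function is a difference of two functions whose supports `hs` puts
    -- inside `D`. The argument covers both uses: `D' = D` with any `χ`, and `D'` the whole space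
    -- with `χ` supported in `D`.
    have t1 : tsupport (fun x => gradient χ x i * φ x) ⊆ D := by
      have : (fun x => gradient χ x i * φ x) = fun x =>
        fderiv ℝ (fun x => χ x * φ x) x (EuclideanSpace.single i 1)
          - χ x * fderiv ℝ φ x (EuclideanSpace.single i 1) := by
        ext x; rw [hfd]; ring
      rw [this]
      exact (tsupport_sub _ _).trans (Set.union_subset
        ((tsupport_fderiv_single_subset _ i).trans (hs φ h3))
        (hs _ ((tsupport_fderiv_single_subset φ i).trans h3)))
    have i1 : IntegrableOn (fun x => u x * (gradient χ x i * φ x)) D :=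
      integrableOn_mul_of_tsupport_subset hD h.locInt (hgc.mul h1.continuous) h2.mul_left t1
    have i2 : IntegrableOn (fun x => u x * (χ x * fderiv ℝ φ x (EuclideanSpace.single i 1))) D :=
      integrableOn_mul_of_tsupport_subset hD h.locInt
        (hχ.continuous.mul (continuous_fderiv_single h1 i))
        (hasCompactSupport_fderiv_single h2 i).mul_left
        (hs _ ((tsupport_fderiv_single_subset φ i).trans h3))
    have i3 : IntegrableOn (fun x => G x i * (χ x * φ x)) D :=
      integrableOn_mul_of_tsupport_subset hD (locallyIntegrableOn_apply h.locInt_grad i)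
        hχφ.continuous hcχφ (hs φ h3)
    simp only [hfd, mul_add] at key
    rw [integral_add i2 i1] at key
    rw [integral_add i3 i1]
    linarith

lemma HasWeakGrad.smooth_mul (hD : IsOpen D) (h : HasWeakGrad D u G) {χ : E d → ℝ}
    (hχ : ContDiff ℝ ∞ χ) :
    HasWeakGrad D (fun x => χ x * u x) (fun x => χ x • G x + u x • gradient χ x) := by
  refine h.smooth_mul_aux hD hχ (fun φ hφ => (tsupport_mul_subset_right).trans hφ)
    (fun x h1 h2 => absurd h2 h1) hD subset_rfl ?_ ?_
  · exact h.locInt.continuousOn_mul hχ.continuous.continuousOn hD.isLocallyClosed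
  · exact (h.locInt_grad.continuousOn_smul hD.isLocallyClosed hχ.continuous.continuousOn).add
      (h.locInt.smul_continuousOn hD.isLocallyClosed
        (continuous_gradient (hχ.of_le (by simp))).continuousOn)

lemma locallyIntegrable_of_tsupport_subset {F : Type*} [NormedAddCommGroup F] {f : E d → F}
    (hf : LocallyIntegrableOn f D volume) {K : Set (E d)} (hK : IsCompact K) (hKD : K ⊆ D)
    (hz : ∀ x ∉ K, f x = 0) : Integrable f :=
  (integrableOn_iff_integrable_of_support_subset
    (Function.support_subset_iff'.2 hz)).1 (hf.integrableOn_compact_subset hKD hK)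

/-- Cutting off with a test function on `D` gives functions on the whole space. -/
lemma HasWeakGrad.smooth_mul_univ (hD : IsOpen D) (h : HasWeakGrad D u G) {χ : E d → ℝ}
    (hχ : ContDiff ℝ ∞ χ) (hc : HasCompactSupport χ) (hs : tsupport χ ⊆ D) :
    HasWeakGrad Set.univ (fun x => χ x * u x) (fun x => χ x • G x + u x • gradient χ x) := by
  have hz : ∀ x ∉ tsupport χ, χ x = 0 ∧ gradient χ x = 0 := fun x hx =>
    ⟨image_eq_zero_of_notMem_tsupport hx, gradient_eq_zero_of_notMem_tsupport hx⟩
  have h0 := h.smooth_mul hD hχ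
  refine h.smooth_mul_aux hD hχ (fun φ hφ => (tsupport_mul_subset_left).trans hs)
    (fun x h1 _ => hz x (fun h => h1 (hs h))) isOpen_univ (Set.subset_univ _) ?_ ?_
  · exact (locallyIntegrable_of_tsupport_subset h0.locInt hc hs
      (fun x hx => by simp [(hz x hx).1])).locallyIntegrable.locallyIntegrableOn _
  · exact (locallyIntegrable_of_tsupport_subset h0.locInt_grad hc hs
      (fun x hx => by simp [hz x hx])).locallyIntegrable.locallyIntegrableOn _

/-! ### Localization and limits of distributional gradients, cutoff functions. -/

lemma HasWeakGrad.mono {D' : Set (E d)} (hD : IsOpen D) (h : HasWeakGrad D u G)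
    (hD' : D' ⊆ D) : HasWeakGrad D' u G where
  locInt := h.locInt.mono_set hD'
  locInt_grad := h.locInt_grad.mono_set hD'
  integral_eq φ h1 h2 h3 i := by
    have z : ∀ x ∉ D', φ x = 0 := fun x hx =>
      image_eq_zero_of_notMem_tsupport (fun h => hx (h3 h))
    have z' : ∀ x ∉ D', fderiv ℝ φ x (EuclideanSpace.single i 1) = 0 := fun x hx =>
      image_eq_zero_of_notMem_tsupport
        (f := fun x => fderiv ℝ φ x (EuclideanSpace.single i 1))
        (fun h => hx (h3 (tsupport_fderiv_single_subset φ i h)))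
    have := h.integral_eq φ h1 h2 (h3.trans hD') i
    rw [setIntegral_eq_of_subset_of_forall_sdiff_eq_zero hD.measurableSet hD',
      setIntegral_eq_of_subset_of_forall_sdiff_eq_zero hD.measurableSet hD'] at this
    · exact this
    · intro x hx; rw [z x hx.2, mul_zero]
    · intro x hx; rw [z' x hx.2, mul_zero]

/-- Having a given distributional gradient is a local property. -/
lemma hasWeakGrad_of_iUnion {ι : Type*} [Nonempty ι] {V : ι → Set (E d)}
    (hD : IsOpen D) (hV : ∀ n, IsOpen (V n)) (hdir : Directed (· ⊆ ·) V) (hVD : ⋃ n, V n = D)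
    (h : ∀ n, HasWeakGrad (V n) u G) : HasWeakGrad D u G where
  locInt x hx := by
    obtain ⟨n, hn⟩ := Set.mem_iUnion.1 (hVD ▸ hx)
    have := (h n).locInt x hn
    rwa [(hV n).nhdsWithin_eq hn, ← hD.nhdsWithin_eq hx] at this
  locInt_grad x hx := by
    obtain ⟨n, hn⟩ := Set.mem_iUnion.1 (hVD ▸ hx)
    have := (h n).locInt_grad x hn
    rwa [(hV n).nhdsWithin_eq hn, ← hD.nhdsWithin_eq hx] at this
  integral_eq φ h1 h2 h3 i := by
    -- Because the cover is directed, the compact support of a test function lies in a single `V n`,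
    -- so no partition of unity is needed.
    obtain ⟨n, hn⟩ := h2.isCompact.elim_directed_cover V hV (hVD ▸ h3) hdir
    have z : ∀ x ∉ V n, φ x = 0 := fun x hx =>
      image_eq_zero_of_notMem_tsupport (fun h => hx (hn h))
    have z' : ∀ x ∉ V n, fderiv ℝ φ x (EuclideanSpace.single i 1) = 0 := fun x hx =>
      image_eq_zero_of_notMem_tsupport
        (f := fun x => fderiv ℝ φ x (EuclideanSpace.single i 1))
        (fun h => hx (hn (tsupport_fderiv_single_subset φ i h)))
    have := (h n).integral_eq φ h1 h2 hn i
    have hVn : V n ⊆ D := hVD ▸ Set.subset_iUnion V n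
    rw [setIntegral_eq_of_subset_of_forall_sdiff_eq_zero hD.measurableSet hVn,
      setIntegral_eq_of_subset_of_forall_sdiff_eq_zero hD.measurableSet hVn]
    · exact this
    · intro x hx; rw [z x hx.2, mul_zero]
    · intro x hx; rw [z' x hx.2, mul_zero]

/-- Dominated convergence for distributional gradients. -/
lemma hasWeakGrad_of_tendsto_ae (hD : IsOpen D) {w : ℕ → E d → ℝ} {W : ℕ → E d → E d}
    (h : ∀ n, HasWeakGrad D (w n) (W n)) {b B : E d → ℝ} (hb : LocallyIntegrableOn b D volume)
    (hB : LocallyIntegrableOn B D volume)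
    (hwb : ∀ n, ∀ᵐ x ∂(volume.restrict D), ‖w n x‖ ≤ b x)
    (hWB : ∀ n, ∀ᵐ x ∂(volume.restrict D), ‖W n x‖ ≤ B x)
    (hw : ∀ᵐ x ∂(volume.restrict D), Tendsto (fun n => w n x) atTop (𝓝 (u x)))
    (hW : ∀ᵐ x ∂(volume.restrict D), Tendsto (fun n => W n x) atTop (𝓝 (G x))) :
    HasWeakGrad D u G := by
  have mu : AEStronglyMeasurable u (volume.restrict D) :=
    aestronglyMeasurable_of_tendsto_ae atTop (fun n => (h n).locInt.aestronglyMeasurable) hw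
  have mG : AEStronglyMeasurable G (volume.restrict D) :=
    aestronglyMeasurable_of_tendsto_ae atTop (fun n => (h n).locInt_grad.aestronglyMeasurable) hW
  have bu : ∀ᵐ x ∂(volume.restrict D), ‖u x‖ ≤ b x := by
    filter_upwards [hw, ae_all_iff.2 hwb] with x h1 h2
    exact le_of_tendsto h1.norm (Eventually.of_forall h2)
  have bG : ∀ᵐ x ∂(volume.restrict D), ‖G x‖ ≤ B x := by
    filter_upwards [hW, ae_all_iff.2 hWB] with x h1 h2
    exact le_of_tendsto h1.norm (Eventually.of_forall h2)
  refine ⟨?_, ?_, fun φ h1 h2 h3 i => ?_⟩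
  · rw [locallyIntegrableOn_iff hD.isLocallyClosed] at hb ⊢
    exact fun k hk hk' => (hb k hk hk').mono'
      (mu.mono_measure (Measure.restrict_mono hk le_rfl))
      (ae_restrict_of_ae_restrict_of_subset hk bu)
  · rw [locallyIntegrableOn_iff hD.isLocallyClosed] at hB ⊢
    exact fun k hk hk' => (hB k hk hk').mono'
      (mG.mono_measure (Measure.restrict_mono hk le_rfl))
      (ae_restrict_of_ae_restrict_of_subset hk bG)
  · have e1 : Tendsto (fun n => ∫ x in D, w n x * fderiv ℝ φ x (EuclideanSpace.single i 1)) atTop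
        (𝓝 (∫ x in D, u x * fderiv ℝ φ x (EuclideanSpace.single i 1))) := by
      refine tendsto_integral_of_dominated_convergence _
        (fun n => (integrableOn_mul_fderiv hD (h n).locInt h1 h2 h3 i).aestronglyMeasurable)
        (integrableOn_mul_fderiv hD hb h1 h2 h3 i).norm ?_ ?_
      · intro n
        filter_upwards [hwb n] with x hx
        rw [norm_mul, norm_mul]
        gcongr
        exact hx.trans (le_abs_self _)
      · filter_upwards [hw] with x hx
        exact hx.mul_const _
    have e2 : Tendsto (fun n => ∫ x in D, W n x i * φ x) atTop
        (𝓝 (∫ x in D, G x i * φ x)) := by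
      refine tendsto_integral_of_dominated_convergence _
        (fun n => (integrableOn_mul_of_tsupport_subset hD
          (locallyIntegrableOn_apply (h n).locInt_grad i) h1.continuous h2 h3).aestronglyMeasurable)
        (integrableOn_mul_of_tsupport_subset hD hB h1.continuous h2 h3).norm ?_ ?_
      · intro n
        filter_upwards [hWB n] with x hx
        rw [norm_mul, norm_mul]
        gcongr
        exact (PiLp.norm_apply_le _ i).trans (hx.trans (le_abs_self _))
      · filter_upwards [hW] with x hx
        exact (((EuclideanSpace.proj (𝕜 := ℝ) i).continuous.tendsto _).comp hx).mul_const _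
    refine tendsto_nhds_unique e1 ?_
    simp only [fun n => (h n).integral_eq φ h1 h2 h3 i]
    exact e2.neg

/-- A smooth cutoff function: equal to `1` near the compact set `K`, supported in `D`. -/
lemma exists_cutoff (hD : IsOpen D) {K : Set (E d)} (hK : IsCompact K) (hKD : K ⊆ D) :
    ∃ χ : E d → ℝ, ContDiff ℝ ∞ χ ∧ HasCompactSupport χ ∧ tsupport χ ⊆ D ∧
      (∀ x, 0 ≤ χ x ∧ χ x ≤ 1) ∧ ∀ x ∈ K, χ x = 1 ∧ gradient χ x = 0 := by
  obtain ⟨L, hL, hKL, hLD⟩ := exists_compact_between hK hD hKD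
  obtain ⟨χ, h1, h2, h3, h4⟩ := exists_contMDiff_support_eq_eq_one_iff (n := ⊤)
    (modelWithCornersSelf ℝ (E d)) isOpen_interior hK.isClosed hKL
  have hr : ∀ x, 0 ≤ χ x ∧ χ x ≤ 1 := fun x => h2 ⟨x, rfl⟩
  have ht : tsupport χ ⊆ L := by
    rw [tsupport, h3]
    exact closure_minimal interior_subset hL.isClosed
  refine ⟨χ, h1.contDiff, hL.of_isClosed_subset (isClosed_tsupport _) ht, ht.trans hLD, hr,
    fun x hx => ?_⟩
  have h1x : χ x = 1 := (h4 x).1 hx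
  refine ⟨h1x, ?_⟩
  -- `χ` is only known to be `1` on `K`, not on a neighbourhood, but `1` is its maximum, so the
  -- gradient vanishes at every point of `K`.
  have : IsLocalMax χ x := Eventually.of_forall fun y => by rw [h1x]; exact (hr y).2
  simp [gradient, this.fderiv_eq_zero]

/-! ### Mollification -/

/-- Cauchy–Schwarz against the constant `1`. It is applied to a mollifier as a probability density
and to Lebesgue measure on `(0,1]`. -/
lemma sq_lintegral_le {α : Type*} [MeasurableSpace α] (ν : Measure α) {g : α → ℝ≥0∞}
    (hg : AEMeasurable g ν) : (∫⁻ x, g x ∂ν) ^ 2 ≤ ν Set.univ * ∫⁻ x, g x ^ 2 ∂ν := by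
  have h := ENNReal.lintegral_mul_le_Lp_mul_Lq ν Real.HolderConjugate.two_two
    (aemeasurable_const (b := (1 : ℝ≥0∞))) hg
  simp only [Pi.mul_apply, one_mul, ENNReal.one_rpow, lintegral_one] at h
  calc (∫⁻ x, g x ∂ν) ^ 2 ≤ (ν Set.univ ^ (1 / (2 : ℝ)) *
        (∫⁻ x, g x ^ (2 : ℝ) ∂ν) ^ (1 / (2 : ℝ))) ^ 2 := by gcongr
    _ = ν Set.univ * ∫⁻ x, g x ^ 2 ∂ν := by
      rw [mul_pow, ← ENNReal.rpow_natCast, ← ENNReal.rpow_natCast, ← ENNReal.rpow_mul,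
        ← ENNReal.rpow_mul]
      norm_num

lemma enorm_add_sq_le {F : Type*} [NormedAddCommGroup F] (a b : F) :
    ‖a + b‖ₑ ^ 2 ≤ 2 * ‖a‖ₑ ^ 2 + 2 * ‖b‖ₑ ^ 2 := by
  calc ‖a + b‖ₑ ^ 2 ≤ (‖a‖ₑ + ‖b‖ₑ) ^ 2 := by gcongr; exact enorm_add_le _ _
    _ ≤ _ := by
      rw [enorm_eq_nnnorm, enorm_eq_nnnorm]
      norm_cast
      rw [← NNReal.coe_le_coe]
      push_cast
      nlinarith [sq_nonneg (‖a‖ - ‖b‖)]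

lemma enorm_sub_sq_le {F : Type*} [NormedAddCommGroup F] (a b : F) :
    ‖a - b‖ₑ ^ 2 ≤ 2 * ‖a‖ₑ ^ 2 + 2 * ‖b‖ₑ ^ 2 := by
  simpa [sub_eq_add_neg] using enorm_add_sq_le a (-b)

lemma eLpNorm_two_sq {α F : Type*} [MeasurableSpace α] [NormedAddCommGroup F] (f : α → F)
    (μ : Measure α) : eLpNorm f 2 μ ^ 2 = ∫⁻ x, ‖f x‖ₑ ^ 2 ∂μ := by
  have := eLpNorm_nnreal_pow_eq_lintegral (f := f) (μ := μ) (p := 2) (by norm_num)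
  simpa using this

/-- A.e. convergence with non-increasing `L²`-norms implies convergence in `L²`. -/
lemma tendsto_lintegral_sub_sq_of_ae {α F : Type*} [MeasurableSpace α] [NormedAddCommGroup F]
    {μ : Measure α} {f : ℕ → α → F} {g : α → F} (hf : ∀ n, AEStronglyMeasurable (f n) μ)
    (hg : MemLp g 2 μ) (hle : ∀ n, ∫⁻ x, ‖f n x‖ₑ ^ 2 ∂μ ≤ ∫⁻ x, ‖g x‖ₑ ^ 2 ∂μ)
    (hlim : ∀ᵐ x ∂μ, Tendsto (fun n => f n x) atTop (𝓝 (g x))) :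
    Tendsto (fun n => ∫⁻ x, ‖f n x - g x‖ₑ ^ 2 ∂μ) atTop (𝓝 0) := by
  set A := ∫⁻ x, ‖g x‖ₑ ^ 2 ∂μ with hA
  have hAtop : A ≠ ⊤ := by
    rw [hA, ← eLpNorm_two_sq]; exact ENNReal.pow_ne_top hg.eLpNorm_ne_top
  have mf : ∀ n, AEMeasurable (fun x => ‖f n x‖ₑ ^ 2) μ := fun n => (hf n).enorm.pow_const 2
  have mg : AEMeasurable (fun x => ‖g x‖ₑ ^ 2) μ := hg.1.enorm.pow_const 2
  have md : ∀ n, AEMeasurable (fun x => ‖f n x - g x‖ₑ ^ 2) μ := fun n =>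
    ((hf n).sub hg.1).enorm.pow_const 2
  -- By `enorm_sub_sq_le` the subtraction is not truncated. Fatou for `s n`, whose pointwise limit
  -- is `4‖g‖²`, then forces the integrals of `‖f n - g‖²` to zero, since `∫ s n + ∫ ‖f n - g‖² ≤
  -- 4A`.
  let s : ℕ → α → ℝ≥0∞ := fun n x => 2 * ‖f n x‖ₑ ^ 2 + 2 * ‖g x‖ₑ ^ 2 - ‖f n x - g x‖ₑ ^ 2
  have ms : ∀ n, AEMeasurable (s n) μ := fun n =>
    (((mf n).const_mul 2).add (mg.const_mul 2)).sub (md n)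
  have hsum : ∀ n, ∫⁻ x, s n x ∂μ + ∫⁻ x, ‖f n x - g x‖ₑ ^ 2 ∂μ ≤ 4 * A := fun n => by
    rw [← lintegral_add_left' (ms n)]
    calc ∫⁻ x, (s n x + ‖f n x - g x‖ₑ ^ 2) ∂μ
        = ∫⁻ x, (2 * ‖f n x‖ₑ ^ 2 + 2 * ‖g x‖ₑ ^ 2) ∂μ := by
          congr 1 with x
          exact tsub_add_cancel_of_le (enorm_sub_sq_le _ _)
      _ ≤ 2 * A + 2 * A := by
          rw [lintegral_add_left' ((mf n).const_mul 2), lintegral_const_mul'' _ (mf n),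
            lintegral_const_mul'' _ mg]
          gcongr
          exact hle n
      _ = 4 * A := by ring
  have hfatou : 4 * A ≤ liminf (fun n => ∫⁻ x, s n x ∂μ) atTop := by
    refine le_trans (le_of_eq ?_) (lintegral_liminf_le' ms)
    rw [hA, ← lintegral_const_mul'' _ mg]
    refine lintegral_congr_ae ?_
    filter_upwards [hlim] with x hx
    have t1 : Tendsto (fun n => ‖f n x‖ₑ ^ 2) atTop (𝓝 (‖g x‖ₑ ^ 2)) :=
      ENNReal.Tendsto.pow hx.enorm
    have t2 : Tendsto (fun n => ‖f n x - g x‖ₑ ^ 2) atTop (𝓝 0) := by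
      have : Tendsto (fun n => f n x - g x) atTop (𝓝 0) := by
        simpa using hx.sub_const (g x)
      simpa using ENNReal.Tendsto.pow (n := 2) this.enorm
    have t3 : Tendsto (fun n => s n x) atTop
        (𝓝 (2 * ‖g x‖ₑ ^ 2 + 2 * ‖g x‖ₑ ^ 2 - 0)) := by
      refine ENNReal.Tendsto.sub ((ENNReal.Tendsto.const_mul t1 (by simp)).add_const _) t2
        (Or.inr (by simp))
    rw [t3.liminf_eq, tsub_zero]
    ring
  rw [ENNReal.tendsto_nhds_zero]
  intro ε hε
  -- The strict inequality `4A - ε < 4A` used below fails for `A = 0`, where the bound is immediate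
  -- anyway.
  rcases eq_or_ne A 0 with h0 | h0
  · filter_upwards with n
    have := hsum n
    rw [h0, mul_zero] at this
    exact (le_add_self.trans this).trans (by simp)
  · have hlt : 4 * A - ε < 4 * A :=
      ENNReal.sub_lt_self (ENNReal.mul_ne_top (by simp) hAtop) (by simp [h0]) hε.ne'
    filter_upwards [eventually_lt_of_lt_liminf (hlt.trans_le hfatou)] with n hn
    have h4 : 4 * A ≠ ⊤ := ENNReal.mul_ne_top (by simp) hAtop
    have hs : ∫⁻ x, s n x ∂μ ≠ ⊤ := ne_top_of_le_ne_top h4 (le_self_add.trans (hsum n))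
    calc ∫⁻ x, ‖f n x - g x‖ₑ ^ 2 ∂μ ≤ 4 * A - ∫⁻ x, s n x ∂μ :=
          ENNReal.le_sub_of_add_le_left hs (hsum n)
      _ ≤ ε := by
          rw [tsub_le_iff_left]
          exact tsub_le_iff_right.1 hn.le

open scoped Convolution in
/-- Young's inequality for mollifiers. -/
lemma lintegral_convolution_sq_le {F : Type*} [NormedAddCommGroup F] [NormedSpace ℝ F]
    (φ : ContDiffBump (0 : E d)) {f : E d → F} (hf : AEStronglyMeasurable f volume) :
    ∫⁻ x, ‖(φ.normed volume ⋆[ContinuousLinearMap.lsmul ℝ ℝ, volume] f) x‖ₑ ^ 2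
      ≤ ∫⁻ x, ‖f x‖ₑ ^ 2 := by
  obtain ⟨g, hg, hfg⟩ := hf
  have hfg2 : ∫⁻ x, ‖f x‖ₑ ^ 2 = ∫⁻ x, ‖g x‖ₑ ^ 2 :=
    lintegral_congr_ae (hfg.mono fun x hx => by simp [hx])
  rw [convolution_congr (ContinuousLinearMap.lsmul ℝ ℝ) (ae_eq_refl _) hfg, hfg2]
  have mg : Measurable fun x => ‖g x‖ₑ := hg.enorm
  have mφ : Measurable fun x => ‖φ.normed volume x‖ₑ :=
    (φ.continuous_normed (μ := volume)).measurable.enorm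
  have hφ1 : ∫⁻ x, ‖φ.normed volume x‖ₑ = 1 := by
    rw [← ofReal_integral_norm_eq_lintegral_enorm (φ.integrable_normed (μ := volume))]
    simp_rw [Real.norm_of_nonneg (φ.nonneg_normed (μ := volume) _)]
    simp [φ.integral_normed (μ := volume)]
  calc ∫⁻ x, ‖(φ.normed volume ⋆[ContinuousLinearMap.lsmul ℝ ℝ, volume] g) x‖ₑ ^ 2
      ≤ ∫⁻ x, ∫⁻ t, ‖φ.normed volume t‖ₑ * ‖g (x - t)‖ₑ ^ 2 := by
        refine lintegral_mono fun x => ?_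
        have mgx : Measurable fun t => ‖g (x - t)‖ₑ := mg.comp (measurable_const.sub measurable_id)
        rw [convolution_lsmul]
        calc ‖∫ t, φ.normed volume t • g (x - t)‖ₑ ^ 2
            ≤ (∫⁻ t, ‖φ.normed volume t • g (x - t)‖ₑ) ^ 2 := by
              gcongr; exact enorm_integral_le_lintegral_enorm _
          -- The mollifier has total mass `1`, so the weighted Cauchy–Schwarz inequality costs no
          -- constant.
          _ = (∫⁻ t, ‖g (x - t)‖ₑ ∂(volume.withDensity fun t => ‖φ.normed volume t‖ₑ)) ^ 2 := by
              rw [lintegral_withDensity_eq_lintegral_mul _ mφ mgx]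
              simp [enorm_smul]
          _ ≤ _ := sq_lintegral_le _ mgx.aemeasurable
          _ = _ := by
              rw [lintegral_withDensity_eq_lintegral_mul _ mφ (mgx.pow_const 2),
                withDensity_apply _ MeasurableSet.univ, setLIntegral_univ, hφ1, one_mul]
              rfl
    _ = ∫⁻ t, ∫⁻ x, ‖φ.normed volume t‖ₑ * ‖g (x - t)‖ₑ ^ 2 := by
        refine lintegral_lintegral_swap (Measurable.aemeasurable ?_)
        exact (mφ.comp measurable_snd).mul
          ((mg.comp (measurable_fst.sub measurable_snd)).pow_const 2)
    _ = ∫⁻ t, ‖φ.normed volume t‖ₑ * ∫⁻ x, ‖g x‖ₑ ^ 2 := by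
        congr 1 with t
        have mgt : Measurable fun x => ‖g (x - t)‖ₑ := mg.comp (measurable_id.sub measurable_const)
        rw [lintegral_const_mul _ (mgt.pow_const 2),
          lintegral_sub_right_eq_self (fun x => ‖g x‖ₑ ^ 2) t]
    _ = _ := by rw [lintegral_mul_const _ mφ, hφ1, one_mul]

open scoped Convolution in
/-- The gradient of a mollification is the mollification of the distributional gradient. -/
lemma gradient_convolution (φ : ContDiffBump (0 : E d)) (h : HasWeakGrad Set.univ u G) (x : E d) :
    gradient (φ.normed volume ⋆[ContinuousLinearMap.lsmul ℝ ℝ, volume] u) x =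
      (φ.normed volume ⋆[ContinuousLinearMap.lsmul ℝ ℝ, volume] G) x := by
  have hu : LocallyIntegrable u volume := locallyIntegrableOn_univ.1 h.locInt
  have hG : LocallyIntegrable G volume := locallyIntegrableOn_univ.1 h.locInt_grad
  set ρ := φ.normed (volume : Measure (E d)) with hρ
  have hρs : ContDiff ℝ ∞ ρ := φ.contDiff_normed
  have hρc : HasCompactSupport ρ := φ.hasCompactSupport_normed
  ext i
  have hd := hρc.hasFDerivAt_convolution_right ((ContinuousLinearMap.lsmul ℝ ℝ).flip) hu
    (hρs.of_le (by simp)) x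
  rw [convolution_flip] at hd
  rw [gradient_apply, hd.fderiv, convolution_precompR_apply _ hu (hρc.fderiv ℝ)
    (hρs.continuous_fderiv (by simp)), convolution_def, convolution_lsmul_swap]
  -- The derivative has been put on the mollifier, and `t ↦ ρ (x - t)` serves as test function. The
  -- sign from differentiating `x - t` cancels the one from integration by parts.
  have hψ : ContDiff ℝ ∞ fun t => ρ (x - t) := hρs.comp (contDiff_const.sub contDiff_id)
  have hψc : HasCompactSupport fun t => ρ (x - t) :=
    hρc.comp_homeomorph (Homeomorph.subLeft x)
  have key := h.integral_eq _ hψ hψc (Set.subset_univ _) i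
  have hfd : ∀ t, fderiv ℝ (fun t => ρ (x - t)) t = - fderiv ℝ ρ (x - t) := fun t => by
    have := ((hρs.differentiable (by simp)).differentiableAt (x := x - t)).hasFDerivAt.comp t
      ((hasFDerivAt_id t).const_sub x)
    rw [show (fun t => ρ (x - t)) = ρ ∘ HSub.hSub x from rfl, this.fderiv]
    ext; simp
  simp only [setIntegral_univ, hfd, neg_apply, mul_neg, integral_neg,
    neg_inj] at key
  have hint : Integrable fun t => ρ (x - t) • G t := by
    have := (hρc.convolutionExists_left (ContinuousLinearMap.lsmul ℝ ℝ) hρs.continuous hG x)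
    exact this.integrable_swap
  have hcomp := (EuclideanSpace.proj (𝕜 := ℝ) i).integral_comp_comm hint
  change ∫ t, ρ (x - t) * G t i = (∫ t, ρ (x - t) • G t) i at hcomp
  rw [← hcomp]
  simp only [ContinuousLinearMap.flip_apply, ContinuousLinearMap.lsmul_apply, smul_eq_mul]
  rw [integral_congr_ae (Eventually.of_forall fun t => mul_comm _ _), key]
  congr 1 with t
  ring

/-- Smooth approximation of functions in `W^{1,2}(ℝ^d)`. -/
lemma exists_smooth_approx (h : HasWeakGrad Set.univ u G) (hu : MemLp u 2 volume)
    (hG : MemLp G 2 volume) : ∃ w : ℕ → E d → ℝ, (∀ n, ContDiff ℝ ∞ (w n)) ∧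
      (∀ᵐ x, Tendsto (fun n => w n x) atTop (𝓝 (u x))) ∧
      (∀ᵐ x, Tendsto (fun n => gradient (w n) x) atTop (𝓝 (G x))) ∧
      Tendsto (fun n => ∫⁻ x, ‖w n x - u x‖ₑ ^ 2) atTop (𝓝 0) ∧
      Tendsto (fun n => ∫⁻ x, ‖gradient (w n) x - G x‖ₑ ^ 2) atTop (𝓝 0) := by
  have hlu : LocallyIntegrable u volume := locallyIntegrableOn_univ.1 h.locInt
  have hlG : LocallyIntegrable G volume := locallyIntegrableOn_univ.1 h.locInt_grad
  -- The outer radius is always twice the inner one: a.e. convergence of mollifications of a locally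
  -- integrable function requires a bounded ratio of radii.
  let φ : ℕ → ContDiffBump (0 : E d) := fun n =>
    ⟨1 / (n + 1), 2 / (n + 1), by positivity, by gcongr; norm_num⟩
  have hφ : Tendsto (fun n => (φ n).rOut) atTop (𝓝 0) := by
    have := (tendsto_one_div_add_atTop_nhds_zero_nat (𝕜 := ℝ)).const_mul 2
    simp only [mul_zero] at this
    refine this.congr fun n => ?_
    simp only [φ]; ring
  have hφ' : ∀ᶠ n in atTop, (φ n).rOut ≤ 2 * (φ n).rIn := Eventually.of_forall fun n => by
    simp only [φ]; apply le_of_eq; ring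
  have au := ContDiffBump.ae_convolution_tendsto_right_of_locallyIntegrable hφ hφ' hlu
  have aG := ContDiffBump.ae_convolution_tendsto_right_of_locallyIntegrable hφ hφ' hlG
  have hs : ∀ n, ContDiff ℝ ∞ (convolution ((φ n).normed volume) u
      (ContinuousLinearMap.lsmul ℝ ℝ) volume) := fun n =>
    (φ n).hasCompactSupport_normed.contDiff_convolution_left _ (φ n).contDiff_normed hlu
  have hgr : ∀ n, gradient (convolution ((φ n).normed volume) u
      (ContinuousLinearMap.lsmul ℝ ℝ) volume) = convolution ((φ n).normed volume) G
      (ContinuousLinearMap.lsmul ℝ ℝ) volume := fun n => funext (gradient_convolution (φ n) h)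
  refine ⟨_, hs, au, ?_, ?_, ?_⟩
  · simpa only [hgr] using aG
  · exact tendsto_lintegral_sub_sq_of_ae (fun n => (hs n).continuous.aestronglyMeasurable) hu
      (fun n => lintegral_convolution_sq_le _ hu.1) au
  · refine tendsto_lintegral_sub_sq_of_ae (fun n => (continuous_gradient
      ((hs n).of_le (by simp))).aestronglyMeasurable) hG (fun n => ?_) (by simpa only [hgr] using aG)
    rw [hgr n]
    exact lintegral_convolution_sq_le _ hG.1

/-! ### Locally square integrable functions -/

/-- `f ∈ L²_loc(D)`. -/
def L2loc {F : Type*} [NormedAddCommGroup F] (D : Set (E d)) (f : E d → F) : Prop :=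
  ∀ K ⊆ D, IsCompact K → MemLp f 2 (volume.restrict K)

section L2loc

variable {F F' : Type*} [NormedAddCommGroup F] [NormedAddCommGroup F'] {f g : E d → F}

lemma L2loc.of_memLp (hf : MemLp f 2 (volume.restrict D)) : L2loc D f := fun _ hK _ =>
  hf.mono_measure (Measure.restrict_mono hK le_rfl)

lemma L2loc.locallyIntegrableOn (hD : IsOpen D) (hf : L2loc D f) :
    LocallyIntegrableOn f D volume := by
  rw [locallyIntegrableOn_iff hD.isLocallyClosed]
  intro K hK hK'
  have : IsFiniteMeasure (volume.restrict K) := ⟨by simpa using hK'.measure_lt_top⟩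
  exact (hf K hK hK').integrable one_le_two

lemma L2loc.of_le {g : E d → F'} (hg : L2loc D g)
    (hf : AEStronglyMeasurable f (volume.restrict D))
    (h : ∀ᵐ x ∂(volume.restrict D), ‖f x‖ ≤ ‖g x‖) : L2loc D f := fun K hK hK' =>
  (hg K hK hK').of_le (hf.mono_measure (Measure.restrict_mono hK le_rfl))
    (ae_restrict_of_ae_restrict_of_subset hK h)

lemma L2loc.add (hf : L2loc D f) (hg : L2loc D g) : L2loc D (f + g) := fun K hK hK' =>
  (hf K hK hK').add (hg K hK hK')

lemma L2loc.sub (hf : L2loc D f) (hg : L2loc D g) : L2loc D (f - g) := fun K hK hK' =>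
  (hf K hK hK').sub (hg K hK hK')

lemma L2loc.const_smul [NormedSpace ℝ F] (c : ℝ) (hf : L2loc D f) : L2loc D (c • f) :=
  fun K hK hK' => (hf K hK hK').const_smul c

lemma l2loc_const (c : F) : L2loc D fun _ => c := fun K _ hK' => by
  have : IsFiniteMeasure (volume.restrict K) := ⟨by simpa using hK'.measure_lt_top⟩
  exact memLp_const c

lemma L2loc.congr (hf : L2loc D f) (h : f =ᵐ[volume.restrict D] g) : L2loc D g :=
  fun K hK hK' => (memLp_congr_ae (ae_restrict_of_ae_restrict_of_subset hK h)).1 (hf K hK hK')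

lemma L2loc.norm (hf : L2loc D f) : L2loc D fun x => ‖f x‖ := fun K hK hK' => (hf K hK hK').norm

lemma memLp_of_eq_zero {K : Set (E d)} (hK : MeasurableSet K) (hf : MemLp f 2 (volume.restrict K))
    (hz : ∀ x ∉ K, f x = 0) : MemLp f 2 volume := by
  rw [← memLp_indicator_iff_restrict hK] at hf
  rwa [Set.indicator_eq_self.2 (Function.support_subset_iff'.2 hz)] at hf

end L2loc

lemma hasWeakGrad_const (hD : IsOpen D) (c : ℝ) : HasWeakGrad D (fun _ => c) 0 := by
  have := hasWeakGrad_gradient hD (contDiff_const (c := c) (n := 1) (𝕜 := ℝ) (E := E d))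
  rwa [gradient_fun_const'] at this

/-! ### The chain rule -/

lemma tendsto_lintegral_mul_of_sq {α : Type*} [MeasurableSpace α] {μ : Measure α}
    {p : ℕ → α → ℝ≥0∞} {q : α → ℝ≥0∞} (hp : ∀ n, AEMeasurable (p n) μ) (hq : AEMeasurable q μ)
    (hpt : Tendsto (fun n => ∫⁻ x, p n x ^ 2 ∂μ) atTop (𝓝 0)) (hqt : ∫⁻ x, q x ^ 2 ∂μ ≠ ⊤) :
    Tendsto (fun n => ∫⁻ x, p n x * q x ∂μ) atTop (𝓝 0) := by
  have h := fun n => ENNReal.lintegral_mul_le_Lp_mul_Lq μ Real.HolderConjugate.two_two (hp n) hq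
  simp only [Pi.mul_apply, ENNReal.rpow_two] at h
  refine tendsto_of_tendsto_of_tendsto_of_le_of_le tendsto_const_nhds ?_ (fun _ => zero_le) h
  have h1 := hpt.ennrpow_const (1 / 2)
  rw [ENNReal.zero_rpow_of_pos (by norm_num)] at h1
  have := ENNReal.Tendsto.mul_const h1 (b := (∫⁻ x, q x ^ 2 ∂μ) ^ (1 / 2 : ℝ))
    (Or.inr (ENNReal.rpow_ne_top_of_nonneg (by norm_num) hqt))
  simpa using this

lemma lintegral_sq_ne_top {α F : Type*} [MeasurableSpace α] [NormedAddCommGroup F]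
    {μ : Measure α} {f : α → F} (hf : MemLp f 2 μ) : ∫⁻ x, ‖f x‖ₑ ^ 2 ∂μ ≠ ⊤ := by
  rw [← eLpNorm_two_sq]; exact ENNReal.pow_ne_top hf.eLpNorm_ne_top

/-- Split `c_n p_n q - c₀ p₀ q` as `c_n (p_n - p₀) q + (c_n - c₀) p₀ q`: the first part is handled
by Cauchy–Schwarz, the second by dominated convergence. In the chain rule `c_n` is a derivative
evaluated along the approximation, which converges only a.e. -/
lemma tendsto_integral_mul_mul {α : Type*} [MeasurableSpace α] {μ : Measure α}
    {p c : ℕ → α → ℝ} {p₀ c₀ q : α → ℝ} (hp : ∀ n, MemLp (p n) 2 μ) (hp₀ : MemLp p₀ 2 μ)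
    (hq : MemLp q 2 μ) (hc : ∀ n, AEStronglyMeasurable (c n) μ) (hc1 : ∀ n x, |c n x| ≤ 1)
    (hpt : Tendsto (fun n => ∫⁻ x, ‖p n x - p₀ x‖ₑ ^ 2 ∂μ) atTop (𝓝 0))
    (hct : ∀ᵐ x ∂μ, Tendsto (fun n => c n x) atTop (𝓝 (c₀ x))) :
    Tendsto (fun n => ∫ x, c n x * p n x * q x ∂μ) atTop (𝓝 (∫ x, c₀ x * p₀ x * q x ∂μ)) := by
  have i0 : Integrable (fun x => p₀ x * q x) μ := hp₀.integrable_mul hq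
  have i1 : ∀ n, Integrable (fun x => c n x * (p n x * q x)) μ := fun n =>
    ((hp n).integrable_mul hq).bdd_mul (hc n) (Eventually.of_forall (hc1 n))
  have i2 : ∀ n, Integrable (fun x => c n x * (p₀ x * q x)) μ := fun n =>
    i0.bdd_mul (hc n) (Eventually.of_forall (hc1 n))
  simp only [mul_assoc]
  have t1 : Tendsto (fun n => ∫ x, c n x * (p₀ x * q x) ∂μ) atTop
      (𝓝 (∫ x, c₀ x * (p₀ x * q x) ∂μ)) := by
    refine tendsto_integral_of_dominated_convergence _ (fun n => (i2 n).aestronglyMeasurable)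
      i0.norm ?_ ?_
    · intro n
      filter_upwards with x
      rw [norm_mul]
      exact mul_le_of_le_one_left (norm_nonneg _) (hc1 n x)
    · filter_upwards [hct] with x hx using hx.mul_const _
  have t2 : Tendsto (fun n => ∫ x, (c n x * (p n x * q x) - c n x * (p₀ x * q x)) ∂μ) atTop
      (𝓝 0) := by
    have := tendsto_integral_of_L1 (μ := μ) (l := atTop) (fun _ => (0 : ℝ))
      aestronglyMeasurable_const
      (F := fun n x => c n x * (p n x * q x) - c n x * (p₀ x * q x))
      (Eventually.of_forall fun n => (i1 n).sub (i2 n)) ?_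
    · simpa using this
    · refine tendsto_of_tendsto_of_tendsto_of_le_of_le tendsto_const_nhds
        (tendsto_lintegral_mul_of_sq (fun n => ((hp n).1.sub hp₀.1).enorm) hq.1.enorm hpt
          (lintegral_sq_ne_top hq)) (fun _ => zero_le) (fun n => ?_)
      refine lintegral_mono fun x => ?_
      simp only [sub_zero, Pi.sub_apply]
      rw [← mul_sub, ← sub_mul, enorm_mul, enorm_mul]
      refine mul_le_of_le_one_left zero_le ?_
      rw [← ofReal_norm]
      exact ENNReal.ofReal_le_one.2 (hc1 n x)
  have := t2.add t1
  rw [zero_add] at this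
  refine this.congr fun n => ?_
  rw [integral_sub (i1 n) (i2 n), sub_add_cancel]

lemma gradient_comp {F : ℝ → ℝ} {f : E d → ℝ} (hF : Differentiable ℝ F) (hf : Differentiable ℝ f)
    (x : E d) : gradient (fun x => F (f x)) x = deriv F (f x) • gradient f x := by
  have := (hF (f x)).hasDerivAt.comp_hasFDerivAt x (hf x).hasFDerivAt
  rw [gradient, show (fun x => F (f x)) = F ∘ f from rfl, this.fderiv, map_smul]
  rfl

/-- Smooth functions approximating `u` on a compact set. -/
lemma exists_smooth_approx_on (hD : IsOpen D) (h : HasWeakGrad D u G) (hu : L2loc D u)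
    (hG : L2loc D G) {K : Set (E d)} (hK : IsCompact K) (hKD : K ⊆ D) :
    ∃ w : ℕ → E d → ℝ, (∀ n, ContDiff ℝ ∞ (w n)) ∧
      (∀ᵐ x ∂(volume.restrict K), Tendsto (fun n => w n x) atTop (𝓝 (u x))) ∧
      Tendsto (fun n => ∫⁻ x in K, ‖w n x - u x‖ₑ ^ 2) atTop (𝓝 0) ∧
      Tendsto (fun n => ∫⁻ x in K, ‖gradient (w n) x - G x‖ₑ ^ 2) atTop (𝓝 0) := by
  obtain ⟨χ, c1, c2, c3, c4, c5⟩ := exists_cutoff hD hK hKD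
  have hz : ∀ x ∉ tsupport χ, χ x = 0 ∧ gradient χ x = 0 := fun x hx =>
    ⟨image_eq_zero_of_notMem_tsupport hx, gradient_eq_zero_of_notMem_tsupport hx⟩
  have hgc : Continuous (gradient χ) := continuous_gradient (c1.of_le (by simp))
  have hgcs : HasCompactSupport (gradient χ) :=
    HasCompactSupport.intro c2 fun x hx => (hz x hx).2
  obtain ⟨M, hM⟩ := hgcs.exists_bound_of_continuous hgc
  have mK : MeasurableSet (tsupport χ) := (isClosed_tsupport _).measurableSet
  -- After the cutoff the function lives in `W^{1,2}(ℝ^d)` and can be mollified globally. On `K`,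
  -- where `χ = 1` and its gradient is `0`, it still has value `u` and gradient `G`.
  have h0 := h.smooth_mul_univ hD c1 c2 c3
  have hu' : MemLp (fun x => χ x * u x) 2 volume := by
    refine memLp_of_eq_zero mK ?_ fun x hx => by simp [(hz x hx).1]
    refine (hu _ c3 c2).of_le (c1.continuous.aestronglyMeasurable.mul (hu _ c3 c2).1) ?_
    filter_upwards with x
    rw [norm_mul]
    exact mul_le_of_le_one_left (norm_nonneg _) (by
      rw [Real.norm_of_nonneg (c4 x).1]; exact (c4 x).2)
  have hG' : MemLp (fun x => χ x • G x + u x • gradient χ x) 2 volume := by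
    refine memLp_of_eq_zero mK ?_ fun x hx => by simp [hz x hx]
    refine MemLp.add (f := fun x => χ x • G x) (g := fun x => u x • gradient χ x) ?_ ?_
    · refine (hG _ c3 c2).of_le (c1.continuous.aestronglyMeasurable.smul (hG _ c3 c2).1) ?_
      filter_upwards with x
      rw [norm_smul]
      exact mul_le_of_le_one_left (norm_nonneg _) (by
        rw [Real.norm_of_nonneg (c4 x).1]; exact (c4 x).2)
    · refine ((hu _ c3 c2).const_smul M).of_le
        ((hu _ c3 c2).1.smul hgc.aestronglyMeasurable) ?_
      filter_upwards with x
      simp only [Pi.smul_apply, norm_smul]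
      rw [mul_comm]
      gcongr
      exact (hM x).trans (le_abs_self _)
  obtain ⟨w, w1, w2, -, w4, w5⟩ := exists_smooth_approx h0 hu' hG'
  refine ⟨w, w1, ?_, ?_, ?_⟩
  · filter_upwards [ae_restrict_of_ae w2, ae_restrict_mem hK.measurableSet] with x hx hxK
    simpa [c5 x hxK] using hx
  · refine tendsto_of_tendsto_of_tendsto_of_le_of_le tendsto_const_nhds w4 (fun _ => zero_le)
      (fun n => ?_)
    refine le_trans (le_of_eq (setLIntegral_congr_fun hK.measurableSet fun x hx => ?_))
      (setLIntegral_le_lintegral K _)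
    simp [c5 x hx]
  · refine tendsto_of_tendsto_of_tendsto_of_le_of_le tendsto_const_nhds w5 (fun _ => zero_le)
      (fun n => ?_)
    refine le_trans (le_of_eq (setLIntegral_congr_fun hK.measurableSet fun x hx => ?_))
      (setLIntegral_le_lintegral K _)
    simp [c5 x hx]

/-- Chain rule for `C¹` functions with derivative bounded by `1`. -/
lemma HasWeakGrad.comp (hD : IsOpen D) (h : HasWeakGrad D u G) (hu : L2loc D u)
    (hG : L2loc D G) {F : ℝ → ℝ} (hF : ContDiff ℝ 1 F) (hF1 : ∀ t, |deriv F t| ≤ 1) :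
    HasWeakGrad D (fun x => F (u x)) (fun x => deriv F (u x) • G x) := by
  have hFd : Differentiable ℝ F := hF.differentiable (by norm_num)
  have hF' : Continuous (deriv F) := hF.continuous_deriv (by norm_num)
  have hlip : ∀ s t, ‖F s - F t‖ ≤ ‖s - t‖ := fun s t => by
    simpa using (convex_univ (𝕜 := ℝ) (E := ℝ)).norm_image_sub_le_of_norm_deriv_le (f := F)
      (fun x _ => hFd x) (fun x _ => hF1 x) (Set.mem_univ t) (Set.mem_univ s)
  have mu := h.locInt.aestronglyMeasurable
  have mG := h.locInt_grad.aestronglyMeasurable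
  have lFu : L2loc D fun x => F (u x) := by
    have : L2loc D fun x => F (u x) - F 0 :=
      hu.of_le ((hF.continuous.comp_aestronglyMeasurable mu).sub aestronglyMeasurable_const)
        (Eventually.of_forall fun x => by simpa using hlip (u x) 0)
    simpa [Pi.add_def] using this.add (l2loc_const (F 0))
  have lFG : L2loc D fun x => deriv F (u x) • G x :=
    hG.of_le ((hF'.comp_aestronglyMeasurable mu).smul mG) (Eventually.of_forall fun x => by
      rw [norm_smul]; exact mul_le_of_le_one_left (norm_nonneg _) (hF1 _))
  refine ⟨lFu.locallyIntegrableOn hD, lFG.locallyIntegrableOn hD, fun φ h1 h2 h3 i => ?_⟩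
  set K := tsupport φ with hKdef
  have hK : IsCompact K := h2
  have z : ∀ x ∉ K, φ x = 0 := fun x hx => image_eq_zero_of_notMem_tsupport hx
  have z' : ∀ x ∉ K, fderiv ℝ φ x (EuclideanSpace.single i 1) = 0 := fun x hx =>
    image_eq_zero_of_notMem_tsupport
      (f := fun x => fderiv ℝ φ x (EuclideanSpace.single i 1))
      (fun h => hx (tsupport_fderiv_single_subset φ i h))
  obtain ⟨w, w1, w2, w4, w5⟩ := exists_smooth_approx_on hD h hu hG hK h3
  have hfin : IsFiniteMeasure (volume.restrict K) := ⟨by simpa using hK.measure_lt_top⟩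
  have memc : ∀ f : E d → ℝ, Continuous f → MemLp f 2 (volume.restrict K) := fun f hf => by
    obtain ⟨C, hC⟩ := hK.exists_bound_of_continuousOn hf.continuousOn
    exact MemLp.of_bound hf.aestronglyMeasurable C (by
      filter_upwards [ae_restrict_mem hK.measurableSet] with x hx using hC x hx)
  have hGi : MemLp (fun x => G x i) 2 (volume.restrict K) :=
    (hG K h3 hK).of_le ((EuclideanSpace.proj (𝕜 := ℝ) i).continuous.comp_aestronglyMeasurable
      (hG K h3 hK).1) (Eventually.of_forall fun x => PiLp.norm_apply_le _ i)
  have cgr : ∀ n, Continuous fun x => gradient (w n) x i := fun n => by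
    simp only [gradient_apply]; exact continuous_fderiv_single (w1 n) i
  -- The identity for smooth `w n` passes to the limit on both sides. Here `F` is 1-Lipschitz, so `F
  -- ∘ w n` converges in `L²(K)`; in `e2` the gradients converge in `L²(K)` and the factors `deriv F
  -- (w n x)` converge a.e., bounded by `1`.
  have e1 := tendsto_integral_mul_mul (μ := volume.restrict K) (p := fun n x => F (w n x))
    (p₀ := fun x => F (u x)) (c := fun _ _ => 1) (c₀ := fun _ => 1)
    (q := fun x => fderiv ℝ φ x (EuclideanSpace.single i 1))
    (fun n => memc _ (hF.continuous.comp (w1 n).continuous)) (lFu K h3 hK)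
    (memc _ (continuous_fderiv_single h1 i)) (fun n => aestronglyMeasurable_const) (by simp)
    (by
      refine tendsto_of_tendsto_of_tendsto_of_le_of_le tendsto_const_nhds w4 (fun _ => zero_le)
        (fun n => lintegral_mono fun x => ?_)
      dsimp only
      gcongr
      exact enorm_le_iff_norm_le.2 (hlip _ _)) (Eventually.of_forall fun x => tendsto_const_nhds)
  have e2 := tendsto_integral_mul_mul (μ := volume.restrict K) (p := fun n x => gradient (w n) x i)
    (p₀ := fun x => G x i) (c := fun n x => deriv F (w n x)) (c₀ := fun x => deriv F (u x))
    (q := φ) (fun n => memc _ (cgr n)) hGi (memc _ h1.continuous)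
    (fun n => (hF'.comp (w1 n).continuous).aestronglyMeasurable) (fun n x => hF1 _)
    (by
      refine tendsto_of_tendsto_of_tendsto_of_le_of_le tendsto_const_nhds w5 (fun _ => zero_le)
        (fun n => lintegral_mono fun x => ?_)
      dsimp only
      gcongr
      exact enorm_le_iff_norm_le.2 (PiLp.norm_apply_le (gradient (w n) x - G x) i))
    (by filter_upwards [w2] with x hx using (hF'.tendsto _).comp hx)
  simp only [one_mul] at e1
  have key : ∀ n, ∫ x in K, F (w n x) * fderiv ℝ φ x (EuclideanSpace.single i 1) =
      - ∫ x in K, deriv F (w n x) * gradient (w n) x i * φ x := fun n => by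
    have := (hasWeakGrad_gradient isOpen_univ (hF.comp ((w1 n).of_le (by simp)))).integral_eq φ h1
      h2 (Set.subset_univ _) i
    simp only [setIntegral_univ, Function.comp_def,
      gradient_comp hFd ((w1 n).differentiable (by simp)), PiLp.smul_apply, smul_eq_mul] at this
    rwa [setIntegral_eq_integral_of_forall_compl_eq_zero
        (fun x hx => by rw [z' x hx, mul_zero]),
      setIntegral_eq_integral_of_forall_compl_eq_zero
        (fun x hx => by rw [z x hx, mul_zero])]
  simp only [key] at e1
  have fin := tendsto_nhds_unique e1 e2.neg
  rw [setIntegral_eq_of_subset_of_forall_sdiff_eq_zero hD.measurableSet h3 (fun x hx => by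
      rw [z' x hx.2, mul_zero]),
    setIntegral_eq_of_subset_of_forall_sdiff_eq_zero hD.measurableSet h3 (fun x hx => by
      rw [z x hx.2, mul_zero])]
  simpa using fin

/-! ### Truncations -/

lemma hasDerivAt_sqrt_sq_add {ε : ℝ} (hε : 0 < ε) (t : ℝ) :
    HasDerivAt (fun t => √(t ^ 2 + ε ^ 2)) (t / √(t ^ 2 + ε ^ 2)) t := by
  have hp : t ^ 2 + ε ^ 2 ≠ 0 := by positivity
  have h := ((hasDerivAt_pow 2 t).add_const (ε ^ 2)).sqrt hp
  convert h using 1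
  simp
  field_simp

/-- Apply the chain rule to `√(t² + ε²)` and let `ε → 0`. The derivatives `t / √(t² + ε²)` are
bounded by `1` and tend to `Real.sign t`, including the value `0` at `t = 0`. -/
lemma HasWeakGrad.abs (hD : IsOpen D) (h : HasWeakGrad D u G) (hu : L2loc D u)
    (hG : L2loc D G) : HasWeakGrad D (fun x => |u x|) (fun x => Real.sign (u x) • G x) := by
  let ε : ℕ → ℝ := fun n => 1 / (n + 1)
  have hε : ∀ n, 0 < ε n := fun n => by positivity
  have hε1 : ∀ n, ε n ≤ 1 := fun n => by
    rw [div_le_one (by positivity)]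
    linarith [(n.cast_nonneg : (0 : ℝ) ≤ n)]
  have ht : Tendsto ε atTop (𝓝 0) := tendsto_one_div_add_atTop_nhds_zero_nat
  have hle : ∀ n (t : ℝ), |t| ≤ √(t ^ 2 + ε n ^ 2) := fun n t => by
    rw [← Real.sqrt_sq_eq_abs]
    exact Real.sqrt_le_sqrt (by nlinarith [sq_nonneg (ε n)])
  have hd1 : ∀ n (t : ℝ), |t / √(t ^ 2 + ε n ^ 2)| ≤ 1 := fun n t => by
    rw [abs_div, abs_of_nonneg (Real.sqrt_nonneg _)]
    exact div_le_one_of_le₀ (hle n t) (Real.sqrt_nonneg _)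
  have hlim : ∀ t : ℝ, Tendsto (fun n => √(t ^ 2 + ε n ^ 2)) atTop (𝓝 |t|) := fun t => by
    have := ((ht.pow 2).const_add (t ^ 2)).sqrt
    simpa [Real.sqrt_sq_eq_abs] using this
  have hcd : ∀ n, ContDiff ℝ 1 fun t : ℝ => √(t ^ 2 + ε n ^ 2) := fun n =>
    ContDiff.sqrt (by fun_prop) fun t => by have := hε n; positivity
  have hder : ∀ n, deriv (fun t : ℝ => √(t ^ 2 + ε n ^ 2)) = fun t => t / √(t ^ 2 + ε n ^ 2) :=
    fun n => funext fun t => (hasDerivAt_sqrt_sq_add (hε n) t).deriv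
  have hw : ∀ n, HasWeakGrad D (fun x => √(u x ^ 2 + ε n ^ 2))
      (fun x => (u x / √(u x ^ 2 + ε n ^ 2)) • G x) := fun n => by
    have := h.comp hD hu hG (hcd n) (by rw [hder]; exact hd1 n)
    rwa [hder] at this
  refine hasWeakGrad_of_tendsto_ae hD hw (b := fun x => |u x| + 1) (B := fun x => ‖G x‖)
    ((hu.norm.add (l2loc_const 1)).locallyIntegrableOn hD) (hG.norm.locallyIntegrableOn hD)
    ?_ ?_ ?_ ?_
  · refine fun n => Eventually.of_forall fun x => ?_
    rw [Real.norm_of_nonneg (Real.sqrt_nonneg _)]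
    refine Real.sqrt_le_iff.2 ⟨by positivity, ?_⟩
    nlinarith [abs_nonneg (u x), sq_abs (u x), hε1 n, hε n]
  · refine fun n => Eventually.of_forall fun x => ?_
    rw [norm_smul]
    exact mul_le_of_le_one_left (norm_nonneg _) (hd1 n _)
  · exact Eventually.of_forall fun x => hlim (u x)
  · refine Eventually.of_forall fun x => ?_
    refine Tendsto.smul_const ?_ (G x)
    rcases eq_or_ne (u x) 0 with h0 | h0
    · simp [h0]
    · have hsign : Real.sign (u x) = u x / |u x| := by
        rcases lt_or_gt_of_ne h0 with h0 | h0
        · rw [Real.sign_of_neg h0, abs_of_neg h0, div_neg, div_self h0.ne]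
        · rw [Real.sign_of_pos h0, abs_of_pos h0, div_self h0.ne']
      rw [hsign]
      exact tendsto_const_nhds.div (hlim (u x)) (abs_ne_zero.2 h0)

lemma HasWeakGrad.sub_const (hD : IsOpen D) (h : HasWeakGrad D u G) (c : ℝ) :
    HasWeakGrad D (fun x => u x - c) G := by
  have := h.sub hD (hasWeakGrad_const hD c)
  simpa [Pi.sub_def] using this

lemma L2loc.sub_const (hu : L2loc D u) (c : ℝ) : L2loc D (fun x => u x - c) :=
  hu.sub (l2loc_const c)

lemma abs_sign_le_one (t : ℝ) : |Real.sign t| ≤ 1 := by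
  rcases Real.sign_apply_eq t with h | h | h <;> simp [h]

/-- The gradient vanishes on level sets. -/
lemma HasWeakGrad.ae_eq_zero_of_eq (hD : IsOpen D) (h : HasWeakGrad D u G) (hu : L2loc D u)
    (hG : L2loc D G) (c : ℝ) : ∀ᵐ x ∂(volume.restrict D), u x = c → G x = 0 := by
  let ε : ℕ → ℝ := fun n => 1 / (n + 1)
  have hε : ∀ n, 0 < ε n := fun n => by positivity
  have hε1 : ∀ n, ε n ≤ 1 := fun n => by
    rw [div_le_one (by positivity)]
    linarith [(n.cast_nonneg : (0 : ℝ) ≤ n)]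
  have ht : Tendsto ε atTop (𝓝 0) := tendsto_one_div_add_atTop_nhds_zero_nat
  have h1 := (h.sub_const hD c).abs hD (hu.sub_const c) hG
  have hw : ∀ n, HasWeakGrad D (fun x => |u x - (c + ε n)|)
      (fun x => Real.sign (u x - (c + ε n)) • G x) := fun n =>
    (h.sub_const hD _).abs hD (hu.sub_const _) hG
  -- Approximating `|u - c|` by `|u - (c + ε)|` with `ε` decreasing to `0` gives the sign `-1` on
  -- `{u = c}`, while `h1` gives the sign `0` there. Uniqueness forces `G = 0` on this set.
  have h2 : HasWeakGrad D (fun x => |u x - c|)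
      (fun x => (if u x ≤ c then (-1 : ℝ) else 1) • G x) := by
    refine hasWeakGrad_of_tendsto_ae hD hw (b := fun x => |u x| + (|c| + 1))
      (B := fun x => ‖G x‖)
      ((hu.norm.add (l2loc_const _)).locallyIntegrableOn hD) (hG.norm.locallyIntegrableOn hD)
      ?_ ?_ ?_ ?_
    · refine fun n => Eventually.of_forall fun x => ?_
      rw [Real.norm_of_nonneg (abs_nonneg _)]
      refine (abs_sub _ _).trans ?_
      gcongr
      refine (abs_add_le _ _).trans ?_
      rw [abs_of_pos (hε n)]
      linarith [hε1 n]
    · refine fun n => Eventually.of_forall fun x => ?_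
      rw [norm_smul]
      exact mul_le_of_le_one_left (norm_nonneg _) (abs_sign_le_one _)
    · refine Eventually.of_forall fun x => ?_
      have := ((ht.const_add c).const_sub (u x)).abs
      simpa using this
    · refine Eventually.of_forall fun x => ?_
      refine Tendsto.smul_const ?_ (G x)
      by_cases hx : u x ≤ c
      · rw [if_pos hx]
        refine tendsto_const_nhds.congr fun n => ?_
        rw [Real.sign_of_neg]
        linarith [hε n]
      · rw [if_neg hx]
        refine tendsto_const_nhds.congr' ?_
        filter_upwards [ht.eventually_lt_const (sub_pos.2 (not_le.1 hx))] with n hn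
        rw [Real.sign_of_pos]
        linarith
  filter_upwards [h1.ae_unique hD h2] with x hx hxc
  simpa [hxc] using hx

/-- `max u a = ½ (u + |u - a|) + a/2`. On `{u = a}` this yields `½ G` instead of `0`, and `G`
vanishes there by the level set lemma. -/
lemma HasWeakGrad.max_const (hD : IsOpen D) (h : HasWeakGrad D u G) (hu : L2loc D u)
    (hG : L2loc D G) (a : ℝ) :
    HasWeakGrad D (fun x => max (u x) a) (fun x => (if a < u x then (1 : ℝ) else 0) • G x) := by
  have h1 := (h.sub_const hD a).abs hD (hu.sub_const a) hG
  have h2 := (((h.add hD h1).const_smul (1 / 2)).sub_const hD (-(a / 2)))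
  refine h2.congr (Eventually.of_forall fun x => ?_) ?_
  · simp only [Pi.smul_apply, Pi.add_apply, smul_eq_mul]
    rcases le_total (u x) a with hx | hx
    · rw [max_eq_right hx, abs_of_nonpos (by linarith)]; ring
    · rw [max_eq_left hx, abs_of_nonneg (by linarith)]; ring
  · filter_upwards [h.ae_eq_zero_of_eq hD hu hG a] with x hx
    simp only [Pi.smul_apply, Pi.add_apply]
    rcases lt_trichotomy (u x) a with hxa | hxa | hxa
    · rw [if_neg hxa.not_gt, Real.sign_of_neg (by linarith)]; simp
    · simp [hx hxa]
    · rw [if_pos hxa, Real.sign_of_pos (by linarith), one_smul, ← two_smul ℝ, smul_smul]; simp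

lemma HasWeakGrad.min_const (hD : IsOpen D) (h : HasWeakGrad D u G) (hu : L2loc D u)
    (hG : L2loc D G) (b : ℝ) :
    HasWeakGrad D (fun x => min (u x) b) (fun x => (if u x < b then (1 : ℝ) else 0) • G x) := by
  have h1 := ((h.const_smul (-1)).max_const hD (hu.const_smul (-1)) (hG.const_smul (-1))
    (-b)).const_smul (-1)
  refine h1.congr (Eventually.of_forall fun x => ?_) (Eventually.of_forall fun x => ?_)
  · simp [max_neg_neg]
  · by_cases hx : u x < b <;> simp [hx]

lemma L2loc.ite_smul (hG : L2loc D G) {p : E d → Prop} [DecidablePred p]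
    (hm : AEStronglyMeasurable (fun x => (if p x then (1 : ℝ) else 0) • G x)
      (volume.restrict D)) :
    L2loc D (fun x => (if p x then (1 : ℝ) else 0) • G x) :=
  hG.of_le hm (Eventually.of_forall fun x => by split_ifs <;> simp)

/-- The gradient of a truncation. -/
lemma HasWeakGrad.clamp (hD : IsOpen D) (h : HasWeakGrad D u G) (hu : L2loc D u)
    (hG : L2loc D G) {a b : ℝ} (hab : a < b) :
    HasWeakGrad D (fun x => min (max (u x) a) b) ({x | a < u x ∧ u x < b}.indicator G) := by
  have h1 := h.max_const hD hu hG a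
  have hu1 : L2loc D (fun x => max (u x) a) :=
    (hu.norm.add (l2loc_const |a|)).of_le h1.locInt.aestronglyMeasurable
      (Eventually.of_forall fun x => by
        simp only [Pi.add_apply, Real.norm_eq_abs]
        refine le_trans ?_ (le_abs_self _)
        refine abs_max_le_max_abs_abs.trans (max_le ?_ ?_) <;>
          linarith [abs_nonneg a, abs_nonneg (u x)])
  have h2 := h1.min_const hD hu1 (hG.ite_smul h1.locInt_grad.aestronglyMeasurable) b
  refine h2.congr ae_eq_rfl (Eventually.of_forall fun x => ?_)
  by_cases hx : a < u x
  · by_cases hx' : u x < b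
    · simp [Set.indicator, hx, hx', hab]
    · simp [Set.indicator, hx, hx']
  · simp [Set.indicator, hx]

/-! ### A Poincaré type inequality -/

lemma norm_gradient (f : E d → ℝ) (x : E d) : ‖gradient f x‖ = ‖fderiv ℝ f x‖ :=
  LinearIsometryEquiv.norm_map _ _

/-- The fundamental theorem of calculus on the segment from `x` to `x + h`, followed by
Cauchy–Schwarz in `t`. -/
lemma enorm_sub_sq_le_lintegral_gradient {f : E d → ℝ} (hf : ContDiff ℝ 1 f) (x h : E d) :
    ‖f (x + h) - f x‖ₑ ^ 2 ≤
      ‖h‖ₑ ^ 2 * ∫⁻ t in Set.Ioc (0 : ℝ) 1, ‖gradient f (x + t • h)‖ₑ ^ 2 := by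
  have hfd : Continuous (fderiv ℝ f) := hf.continuous_fderiv (by norm_num)
  have hc : Continuous fun t : ℝ => fderiv ℝ f (x + t • h) h :=
    (hfd.comp (by fun_prop)).clm_apply continuous_const
  have hcg : Continuous fun t : ℝ => ‖gradient f (x + t • h)‖ₑ :=
    ((continuous_gradient hf).comp (by fun_prop)).enorm
  have hder : ∀ t ∈ Set.uIcc (0 : ℝ) 1,
      HasDerivAt (fun t : ℝ => f (x + t • h)) (fderiv ℝ f (x + t • h) h) t := fun t _ => by
    have h1 : HasDerivAt (fun t : ℝ => x + t • h) h t := by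
      simpa using ((hasDerivAt_id t).smul_const h).const_add x
    exact ((hf.differentiable (by norm_num)).differentiableAt.hasFDerivAt).comp_hasDerivAt t h1
  have hint := intervalIntegral.integral_eq_sub_of_hasDerivAt hder
    (hc.intervalIntegrable _ _)
  simp only [one_smul, zero_smul, add_zero] at hint
  rw [← hint, intervalIntegral.integral_of_le zero_le_one]
  calc ‖∫ t in Set.Ioc (0 : ℝ) 1, fderiv ℝ f (x + t • h) h‖ₑ ^ 2
      ≤ (∫⁻ t in Set.Ioc (0 : ℝ) 1, ‖h‖ₑ * ‖gradient f (x + t • h)‖ₑ) ^ 2 := by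
        gcongr
        refine (enorm_integral_le_lintegral_enorm _).trans (lintegral_mono fun t => ?_)
        dsimp only
        rw [← ofReal_norm, ← ofReal_norm, ← ofReal_norm, ← ENNReal.ofReal_mul (norm_nonneg _)]
        refine ENNReal.ofReal_le_ofReal ?_
        rw [norm_gradient, mul_comm]
        exact (fderiv ℝ f (x + t • h)).le_opNorm h
    _ = ‖h‖ₑ ^ 2 * (∫⁻ t in Set.Ioc (0 : ℝ) 1, ‖gradient f (x + t • h)‖ₑ) ^ 2 := by
        rw [lintegral_const_mul _ hcg.measurable, mul_pow]
    _ ≤ _ := by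
        gcongr
        refine (sq_lintegral_le _ hcg.measurable.aemeasurable).trans (le_of_eq ?_)
        simp

/-- Write `y = x + h` with `‖h‖ < 2r`; the segment from `x` to `y` stays in the ball of radius `3r`.
With the squared gradient extended by zero outside that ball, integrate in `x` over the whole space
first: translation invariance removes the dependence on `t` and `h`, leaving the volume of the ball
of admissible `h`. -/
lemma lintegral_lintegral_sub_sq_le_of_contDiff {f : E d → ℝ} (hf : ContDiff ℝ 1 f) (c : E d)
    (r : ℝ) :
    ∫⁻ x in Metric.ball c r, ∫⁻ y in Metric.ball c r, ‖f x - f y‖ₑ ^ 2 ≤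
      ENNReal.ofReal (2 * r) ^ 2 * (volume (Metric.ball (0 : E d) (2 * r)) *
        ∫⁻ z in Metric.ball c (3 * r), ‖gradient f z‖ₑ ^ 2) := by
  have mG : Measurable fun z => ‖gradient f z‖ₑ ^ 2 :=
    ((continuous_gradient hf).enorm.measurable).pow_const 2
  set Q : E d → ℝ≥0∞ := (Metric.ball c (3 * r)).indicator fun z => ‖gradient f z‖ₑ ^ 2 with hQ
  have mQ : Measurable Q := mG.indicator measurableSet_ball
  set B := Metric.ball c r
  set B2 := Metric.ball (0 : E d) (2 * r)
  have step : ∀ x ∈ B, ∫⁻ y in B, ‖f x - f y‖ₑ ^ 2 ≤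
      ∫⁻ h in B2, ENNReal.ofReal (2 * r) ^ 2 * ∫⁻ t in Set.Ioc (0 : ℝ) 1, Q (x + t • h) := by
    intro x hx
    rw [← lintegral_indicator measurableSet_ball, ← lintegral_indicator measurableSet_ball,
      ← lintegral_add_left_eq_self _ x]
    refine lintegral_mono fun h => ?_
    by_cases hxh : x + h ∈ B
    · have hh : h ∈ B2 := by
        rw [mem_ball_zero_iff]
        have h1 : ‖x + h - c‖ < r := mem_ball_iff_norm.1 hxh
        have h2 : ‖x - c‖ < r := mem_ball_iff_norm.1 hx
        calc ‖h‖ = ‖(x + h - c) - (x - c)‖ := by congr 1; abel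
          _ ≤ ‖x + h - c‖ + ‖x - c‖ := norm_sub_le _ _
          _ < 2 * r := by linarith
      rw [Set.indicator_of_mem hxh, Set.indicator_of_mem hh, enorm_sub_rev]
      refine (enorm_sub_sq_le_lintegral_gradient hf x h).trans ?_
      have hh' : ‖h‖ < 2 * r := mem_ball_zero_iff.1 hh
      refine mul_le_mul' (pow_le_pow_left' ?_ 2) ?_
      · rw [← ofReal_norm]
        exact ENNReal.ofReal_le_ofReal hh'.le
      · refine setLIntegral_mono' measurableSet_Ioc fun t ht => ?_
        rw [hQ, Set.indicator_of_mem]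
        rw [mem_ball_iff_norm]
        have h2 : ‖x - c‖ < r := mem_ball_iff_norm.1 hx
        calc ‖x + t • h - c‖ = ‖(x - c) + t • h‖ := by congr 1; abel
          _ ≤ ‖x - c‖ + ‖t • h‖ := norm_add_le _ _
          _ ≤ ‖x - c‖ + ‖h‖ := by
            gcongr
            rw [norm_smul, Real.norm_of_nonneg ht.1.le]
            exact mul_le_of_le_one_left (norm_nonneg _) ht.2
          _ < 3 * r := by linarith
    · rw [Set.indicator_of_notMem hxh]
      exact zero_le
  have m3 : Measurable fun p : (E d × E d) × ℝ => Q (p.1.1 + p.2 • p.1.2) :=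
    mQ.comp (by fun_prop)
  have m2 : Measurable fun p : E d × E d => ∫⁻ t in Set.Ioc (0 : ℝ) 1, Q (p.1 + t • p.2) :=
    m3.lintegral_prod_right'
  calc ∫⁻ x in B, ∫⁻ y in B, ‖f x - f y‖ₑ ^ 2
      ≤ ∫⁻ x in B, ∫⁻ h in B2, ENNReal.ofReal (2 * r) ^ 2 *
          ∫⁻ t in Set.Ioc (0 : ℝ) 1, Q (x + t • h) := setLIntegral_mono' measurableSet_ball step
    _ ≤ ∫⁻ x, ∫⁻ h in B2, ENNReal.ofReal (2 * r) ^ 2 *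
          ∫⁻ t in Set.Ioc (0 : ℝ) 1, Q (x + t • h) := setLIntegral_le_lintegral _ _
    _ = ENNReal.ofReal (2 * r) ^ 2 * ∫⁻ x, ∫⁻ h in B2,
          ∫⁻ t in Set.Ioc (0 : ℝ) 1, Q (x + t • h) := by
        rw [← lintegral_const_mul' _ _ (by finiteness)]
        congr 1 with x
        rw [lintegral_const_mul' _ _ (by finiteness)]
    _ = ENNReal.ofReal (2 * r) ^ 2 * ∫⁻ h in B2, ∫⁻ x,
          ∫⁻ t in Set.Ioc (0 : ℝ) 1, Q (x + t • h) := by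
        rw [lintegral_lintegral_swap m2.aemeasurable]
    _ = ENNReal.ofReal (2 * r) ^ 2 * ∫⁻ h in B2, ∫⁻ t in Set.Ioc (0 : ℝ) 1, ∫⁻ x,
          Q (x + t • h) := by
        congr 2 with h
        have : Measurable fun p : E d × ℝ => Q (p.1 + p.2 • h) := mQ.comp (by fun_prop)
        rw [lintegral_lintegral_swap this.aemeasurable]
    _ = ENNReal.ofReal (2 * r) ^ 2 * (volume B2 * ∫⁻ z, Q z) := by
        simp only [lintegral_add_right_eq_self Q, setLIntegral_const, Real.volume_Ioc, sub_zero,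
          ENNReal.ofReal_one, mul_one]
        rw [mul_comm (volume B2)]
    _ = _ := by rw [hQ, lintegral_indicator measurableSet_ball]

/-- The double integral of differences over a ball is controlled by the energy on a larger ball. -/
lemma HasWeakGrad.lintegral_lintegral_sub_sq_le (hD : IsOpen D) (h : HasWeakGrad D u G)
    (hu : L2loc D u) (hG : L2loc D G) {c : E d} {r : ℝ} (hr : 0 ≤ r)
    (hcr : Metric.closedBall c (3 * r) ⊆ D) :
    ∫⁻ x in Metric.ball c r, ∫⁻ y in Metric.ball c r, ‖u x - u y‖ₑ ^ 2 ≤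
      ENNReal.ofReal (2 * r) ^ 2 * (volume (Metric.ball (0 : E d) (2 * r)) *
        (2 * ∫⁻ z in D, ‖G z‖ₑ ^ 2)) := by
  set K := Metric.closedBall c (3 * r)
  have hK : IsCompact K := isCompact_closedBall _ _
  set B := Metric.ball c r
  have hBK : B ⊆ K := Metric.ball_subset_closedBall.trans
    (Metric.closedBall_subset_closedBall (by linarith))
  obtain ⟨w, w1, w2, -, w4⟩ := exists_smooth_approx_on hD h hu hG hK hcr
  set C : ℝ≥0∞ := ENNReal.ofReal (2 * r) ^ 2
  set V := volume (Metric.ball (0 : E d) (2 * r))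
  have hV : V ≠ ⊤ := measure_ball_lt_top.ne
  have w2' : ∀ᵐ x ∂(volume.restrict B), Tendsto (fun n => w n x) atTop (𝓝 (u x)) :=
    ae_restrict_of_ae_restrict_of_subset hBK w2
  have mw : ∀ n, Measurable fun p : E d × E d => ‖w n p.1 - w n p.2‖ₑ ^ 2 := fun n => by
    have : Continuous fun p : E d × E d => w n p.1 - w n p.2 :=
      ((w1 n).continuous.comp continuous_fst).sub ((w1 n).continuous.comp continuous_snd)
    exact this.enorm.measurable.pow_const 2
  -- On the left a.e. convergence suffices, through Fatou in each variable. On the right the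
  -- gradients converge in `L²(K)`; the factor `2` of the final bound is the price of `‖a + b‖² ≤
  -- 2‖a‖² + 2‖b‖²`.
  have fatou : ∫⁻ x in B, ∫⁻ y in B, ‖u x - u y‖ₑ ^ 2 ≤
      liminf (fun n => ∫⁻ x in B, ∫⁻ y in B, ‖w n x - w n y‖ₑ ^ 2) atTop := by
    refine le_trans (lintegral_mono_ae ?_) (lintegral_liminf_le'
      fun n => ((mw n).lintegral_prod_right').aemeasurable)
    filter_upwards [w2'] with x hx
    refine le_trans (le_of_eq (lintegral_congr_ae ?_)) (lintegral_liminf_le'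
      fun n => ((mw n).comp measurable_prodMk_left).aemeasurable)
    filter_upwards [w2'] with y hy
    exact (ENNReal.Tendsto.pow (hx.sub hy).enorm).liminf_eq.symm
  refine fatou.trans ?_
  have bound : ∀ n, ∫⁻ x in B, ∫⁻ y in B, ‖w n x - w n y‖ₑ ^ 2 ≤
      C * (V * (2 * (∫⁻ z in K, ‖gradient (w n) z - G z‖ₑ ^ 2) + 2 * ∫⁻ z in D, ‖G z‖ₑ ^ 2)) := by
    intro n
    refine (lintegral_lintegral_sub_sq_le_of_contDiff ((w1 n).of_le (by simp)) c r).trans ?_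
    gcongr
    calc ∫⁻ z in Metric.ball c (3 * r), ‖gradient (w n) z‖ₑ ^ 2
        ≤ ∫⁻ z in K, ‖gradient (w n) z‖ₑ ^ 2 :=
          lintegral_mono_set Metric.ball_subset_closedBall
      _ ≤ ∫⁻ z in K, (2 * ‖gradient (w n) z - G z‖ₑ ^ 2 + 2 * ‖G z‖ₑ ^ 2) := by
          refine lintegral_mono fun z => ?_
          simpa using enorm_add_sq_le (gradient (w n) z - G z) (G z)
      _ = 2 * (∫⁻ z in K, ‖gradient (w n) z - G z‖ₑ ^ 2) + 2 * ∫⁻ z in K, ‖G z‖ₑ ^ 2 := by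
          rw [lintegral_add_right' _ (((hG K hcr hK).1.enorm.pow_const 2).const_mul 2),
            lintegral_const_mul' _ _ (by simp), lintegral_const_mul' _ _ (by simp)]
      _ ≤ _ := by
          gcongr
  have lim : Tendsto (fun n => C * (V * (2 * (∫⁻ z in K, ‖gradient (w n) z - G z‖ₑ ^ 2) +
      2 * ∫⁻ z in D, ‖G z‖ₑ ^ 2))) atTop (𝓝 (C * (V * (2 * 0 + 2 * ∫⁻ z in D, ‖G z‖ₑ ^ 2)))) :=
    ENNReal.Tendsto.const_mul (ENNReal.Tendsto.const_mul
      ((ENNReal.Tendsto.const_mul (a := 2) w4 (Or.inr (by simp))).add_const _) (Or.inr hV))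
      (Or.inr (by simp only [C]; finiteness))
  refine (liminf_le_liminf (Eventually.of_forall bound)).trans ?_
  rw [lim.liminf_eq]
  simp

/-! ### Integer truncations and local square integrability. -/

lemma trunc_eq {α : Type*} (k : ℕ) (f : α → ℝ) :
    trunc k f = fun x => min (max (f x) (-(k : ℝ))) k := by
  ext x; simp only [trunc, max_comm]

lemma abs_trunc_le {α : Type*} (k : ℕ) (f : α → ℝ) (x : α) : |trunc k f x| ≤ |f x| := by
  have : (0 : ℝ) ≤ k := k.cast_nonneg
  unfold trunc
  rcases le_total (-(k : ℝ)) (f x) with h | h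
  · rw [max_eq_right h]
    rcases le_total (f x) k with h' | h'
    · rw [min_eq_left h']
    · rw [min_eq_right h', abs_of_nonneg this]
      exact h'.trans (le_abs_self _)
  · rw [max_eq_left h, min_eq_left (by linarith), abs_neg, abs_of_nonneg this]
    exact (le_neg.1 h).trans (neg_le_abs _)

lemma abs_trunc_le_natCast {α : Type*} (k : ℕ) (f : α → ℝ) (x : α) : |trunc k f x| ≤ k := by
  have : (0 : ℝ) ≤ k := k.cast_nonneg
  rw [abs_le]
  exact ⟨le_min (le_max_left _ _) (by linarith), min_le_right _ _⟩

lemma trunc_eq_self {α : Type*} {k : ℕ} {f : α → ℝ} {x : α} (h : |f x| ≤ k) :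
    trunc k f x = f x := by
  rw [abs_le] at h
  rw [trunc, max_eq_right h.1, min_eq_left h.2]

lemma tendsto_trunc {α : Type*} (f : α → ℝ) (x : α) :
    Tendsto (fun k => trunc k f x) atTop (𝓝 (f x)) := by
  refine tendsto_const_nhds.congr' ?_
  filter_upwards [eventually_ge_atTop ⌈|f x|⌉₊] with k hk
  rw [trunc_eq_self ((Nat.le_ceil _).trans (by exact_mod_cast hk))]

/-- A function whose truncations have bounded energy is locally square integrable. -/
lemma l2loc_of_trunc (hD : IsOpen D) {f : E d → ℝ}
    (hf : AEStronglyMeasurable f (volume.restrict D)) {W : ℕ → E d → E d}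
    (hW : ∀ k, 1 ≤ k → HasWeakGrad D (trunc k f) (W k))
    (hW2 : ∀ k, 1 ≤ k → L2loc D (W k)) {A : ℝ≥0∞} (hA : A ≠ ⊤)
    (hWA : ∀ k, 1 ≤ k → ∫⁻ x in D, ‖W k x‖ₑ ^ 2 ≤ A) : L2loc D f := by
  have hk2 : ∀ k, 1 ≤ k → L2loc D (trunc k f) := fun k hk =>
    (l2loc_const (k : ℝ)).of_le (hW k hk).locInt.aestronglyMeasurable
      (Eventually.of_forall fun x => by
        rw [Real.norm_eq_abs]
        exact (abs_trunc_le_natCast k f x).trans (le_abs_self _))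
  have ball_fin : ∀ (c : E d) (r : ℝ), 0 < r → Metric.closedBall c (3 * r) ⊆ D →
      ∫⁻ x in Metric.ball c r, ‖f x‖ₑ ^ 2 < ⊤ := by
    intro c r hr hcr
    set B := Metric.ball c r
    have hBD : B ⊆ D := (Metric.ball_subset_closedBall.trans
      (Metric.closedBall_subset_closedBall (by linarith))).trans hcr
    have hfB : AEStronglyMeasurable f (volume.restrict B) :=
      hf.mono_measure (Measure.restrict_mono hBD le_rfl)
    -- A measurable representative is used to have measurable sublevel sets.
    obtain ⟨g, hg, hfg⟩ := hfB
    have mB : MeasurableSet B := measurableSet_ball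
    have mS : ∀ M : ℕ, MeasurableSet (B ∩ {y | |g y| ≤ M}) := fun M =>
      mB.inter (measurableSet_le hg.measurable.abs measurable_const)
    -- The function is finite everywhere, so its sublevel sets exhaust the ball and one of them is
    -- not null. This set `S` replaces the mean value of the usual Poincaré inequality, which is not
    -- yet known to exist.
    obtain ⟨M, hM⟩ : ∃ M : ℕ, volume (B ∩ {y | |g y| ≤ M}) ≠ 0 := by
      by_contra! hcon
      have h1 : volume B ≤ 0 := by
        calc volume B ≤ volume (⋃ M : ℕ, (B ∩ {y | |g y| ≤ M})) := by
              refine measure_mono fun y hy => Set.mem_iUnion.2 ?_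
              exact ⟨⌈|g y|⌉₊, hy, show |g y| ≤ _ from Nat.le_ceil _⟩
          _ = 0 := measure_iUnion_null hcon
      exact (Metric.measure_ball_pos volume c hr).not_ge h1
    set S := B ∩ {y | |g y| ≤ M}
    have hSB : S ⊆ B := Set.inter_subset_left
    have hSfin : volume S ≠ ⊤ := ne_top_of_le_ne_top measure_ball_lt_top.ne (measure_mono hSB)
    have hfS : ∀ᵐ y ∂(volume.restrict S), |f y| ≤ M := by
      filter_upwards [ae_restrict_of_ae_restrict_of_subset hSB hfg, ae_restrict_mem (mS M)]
        with y h1 h2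
      rw [h1]; exact h2.2
    set R : ℝ≥0∞ := 2 * (ENNReal.ofReal (2 * r) ^ 2 * (volume (Metric.ball (0 : E d) (2 * r)) *
        (2 * A))) + 2 * ENNReal.ofReal M ^ 2 * volume S * volume B
    have hR : R ≠ ⊤ := by
      have : volume (Metric.ball (0 : E d) (2 * r)) ≠ ⊤ := measure_ball_lt_top.ne
      have : volume B ≠ ⊤ := measure_ball_lt_top.ne
      finiteness
    have main : ∀ k, 1 ≤ k → ∫⁻ x in B, ‖trunc k f x‖ₑ ^ 2 ≤ R / volume S := by
      intro k hk
      rw [ENNReal.le_div_iff_mul_le (Or.inl hM) (Or.inl hSfin),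
        ← lintegral_mul_const' _ _ hSfin]
      -- Integrate `|f_k(x)|² ≤ 2|f_k(x) - f_k(y)|² + 2M²` over `y ∈ S`. The bound `|f_k| ≤ |f| ≤ M`
      -- on `S` does not depend on `k`.
      have pt : ∀ x, ‖trunc k f x‖ₑ ^ 2 * volume S ≤
          2 * (∫⁻ y in B, ‖trunc k f x - trunc k f y‖ₑ ^ 2) + 2 * ENNReal.ofReal M ^ 2 * volume S := by
        intro x
        calc ‖trunc k f x‖ₑ ^ 2 * volume S = ∫⁻ y in S, ‖trunc k f x‖ₑ ^ 2 := by
              rw [setLIntegral_const]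
          _ ≤ ∫⁻ y in S, (2 * ‖trunc k f x - trunc k f y‖ₑ ^ 2 + 2 * ENNReal.ofReal M ^ 2) := by
              refine lintegral_mono_ae ?_
              filter_upwards [hfS] with y hy
              have h1 := enorm_add_sq_le (trunc k f x - trunc k f y) (trunc k f y)
              rw [sub_add_cancel] at h1
              refine h1.trans ?_
              gcongr
              rw [← ofReal_norm]
              exact ENNReal.ofReal_le_ofReal ((abs_trunc_le k f y).trans hy)
          _ = 2 * (∫⁻ y in S, ‖trunc k f x - trunc k f y‖ₑ ^ 2)
              + 2 * ENNReal.ofReal M ^ 2 * volume S := by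
              rw [lintegral_add_right _ measurable_const, lintegral_const_mul' _ _ (by simp),
                setLIntegral_const]
          _ ≤ _ := by gcongr
      calc ∫⁻ x in B, ‖trunc k f x‖ₑ ^ 2 * volume S
          ≤ ∫⁻ x in B, (2 * (∫⁻ y in B, ‖trunc k f x - trunc k f y‖ₑ ^ 2)
            + 2 * ENNReal.ofReal M ^ 2 * volume S) := lintegral_mono pt
        _ = 2 * (∫⁻ x in B, ∫⁻ y in B, ‖trunc k f x - trunc k f y‖ₑ ^ 2)
            + 2 * ENNReal.ofReal M ^ 2 * volume S * volume B := by
            rw [lintegral_add_right _ measurable_const, lintegral_const_mul' _ _ (by simp),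
                setLIntegral_const]
        _ ≤ R := by
            have h1 := (hW k hk).lintegral_lintegral_sub_sq_le hD (hk2 k hk) (hW2 k hk) hr.le hcr
            have h2 := hWA k hk
            simp only [R]
            gcongr
            refine h1.trans ?_
            gcongr
    have fatou : ∫⁻ x in B, ‖f x‖ₑ ^ 2 ≤ R / volume S := by
      have mt : ∀ k, AEMeasurable (fun x => ‖trunc (k + 1) f x‖ₑ ^ 2) (volume.restrict B) :=
        fun k => (((hW (k + 1) (by omega)).locInt.aestronglyMeasurable.mono_measure
          (Measure.restrict_mono hBD le_rfl)).enorm.pow_const 2)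
      calc ∫⁻ x in B, ‖f x‖ₑ ^ 2
          = ∫⁻ x in B, liminf (fun k => ‖trunc (k + 1) f x‖ₑ ^ 2) atTop := by
            congr 1 with x
            exact (ENNReal.Tendsto.pow ((tendsto_trunc f x).comp
              (tendsto_add_atTop_nat 1)).enorm).liminf_eq.symm
        _ ≤ liminf (fun k => ∫⁻ x in B, ‖trunc (k + 1) f x‖ₑ ^ 2) atTop := lintegral_liminf_le' mt
        _ ≤ liminf (fun _ : ℕ => R / volume S) atTop :=
            liminf_le_liminf (Eventually.of_forall fun k => main (k + 1) (by omega))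
        _ = R / volume S := by simp
    exact fatou.trans_lt (ENNReal.div_lt_top hR hM)
  intro K hKD hK
  refine ⟨hf.mono_measure (Measure.restrict_mono hKD le_rfl), ?_⟩
  have hfin : ∫⁻ x in K, ‖f x‖ₑ ^ 2 < ⊤ := by
    refine hK.induction_on (p := fun s => ∫⁻ x in s, ‖f x‖ₑ ^ 2 < ⊤) (by simp)
      (fun s t hst ht => (lintegral_mono_set hst).trans_lt ht)
      (fun s t hs ht => (lintegral_union_le _ s t).trans_lt (ENNReal.add_lt_top.2 ⟨hs, ht⟩)) ?_
    intro x hx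
    obtain ⟨ε, hε, hεD⟩ := Metric.isOpen_iff.1 hD x (hKD hx)
    -- The Poincaré type inequality on a ball needs three times its radius inside `D`; here that is
    -- `ε / 2`.
    have : Metric.closedBall x (3 * (ε / 6)) ⊆ D :=
      (Metric.closedBall_subset_ball (by linarith)).trans hεD
    exact ⟨Metric.ball x (ε / 6), mem_nhdsWithin_of_mem_nhds
      (Metric.ball_mem_nhds x (by positivity)), ball_fin x _ (by positivity) this⟩
  rw [← eLpNorm_two_sq] at hfin
  exact lt_top_iff_ne_top.2 fun htop => by simp [htop] at hfin

/-! ### Lower semicontinuity of the energy -/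

/-- Banach–Alaoglu in the dual, transported by the Riesz isometry. The limit is taken along a
nonprincipal ultrafilter, so neither a subsequence nor separability of `H` is involved. -/
lemma exists_weak_limit {H : Type*} [NormedAddCommGroup H] [InnerProductSpace ℝ H]
    [CompleteSpace H] {a : ℕ → H} {C : ℝ} (ha : ∀ n, ‖a n‖ ≤ C) :
    ∃ b : H, ‖b‖ ≤ C ∧ ∀ y, Tendsto (fun n => inner ℝ (a n) y) (hyperfilter ℕ : Filter ℕ)
      (𝓝 (inner ℝ b y)) := by
  let f : ℕ → WeakDual ℝ H := fun n =>
    StrongDual.toWeakDual (InnerProductSpace.toDual ℝ H (a n))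
  have hc := WeakDual.isCompact_closedBall (𝕜 := ℝ) (E := H) 0 C
  obtain ⟨x, hx, hxl⟩ := hc.ultrafilter_le_nhds ((hyperfilter ℕ).map f) (by
    rw [le_principal_iff]
    refine Eventually.of_forall (p := fun n => f n ∈ _) fun n => ?_
    rw [Set.mem_preimage, mem_closedBall_zero_iff]
    exact ((InnerProductSpace.toDual ℝ H).norm_map (a n)).le.trans (ha n))
  refine ⟨(InnerProductSpace.toDual ℝ H).symm (WeakDual.toStrongDual x), ?_, fun y => ?_⟩
  · rw [LinearIsometryEquiv.norm_map]
    exact mem_closedBall_zero_iff.1 hx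
  · rw [InnerProductSpace.toDual_symm_apply]
    exact ((WeakDual.eval_continuous y).tendsto x).comp (show Tendsto f _ _ from hxl)

/-- The gradients are bounded in `L²`, so they have a weak limit of no larger norm. In the
integration by parts identity the functions pass to the limit by dominated convergence, and the
gradients by weak convergence against the field `φ e_i`. -/
lemma hasWeakGrad_of_energy_le_of_dominated (hD : IsOpen D) {w : ℕ → E d → ℝ}
    {W : ℕ → E d → E d} (h : ∀ n, HasWeakGrad D (w n) (W n)) {A : ℝ≥0∞} (hA : A ≠ ⊤)
    (hWA : ∀ n, ∫⁻ x in D, ‖W n x‖ₑ ^ 2 ≤ A) {b : E d → ℝ} (hb : LocallyIntegrableOn b D volume)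
    (hwb : ∀ n, ∀ᵐ x ∂(volume.restrict D), ‖w n x‖ ≤ b x)
    (hw : ∀ᵐ x ∂(volume.restrict D), Tendsto (fun n => w n x) atTop (𝓝 (u x))) :
    ∃ G, HasWeakGrad D u G ∧ MemLp G 2 (volume.restrict D) ∧ ∫⁻ x in D, ‖G x‖ₑ ^ 2 ≤ A := by
  have hWle : ∀ n, eLpNorm (W n) 2 (volume.restrict D) ≤ A ^ (1 / 2 : ℝ) := fun n => by
    have := hWA n
    rw [← eLpNorm_two_sq] at this
    calc eLpNorm (W n) 2 (volume.restrict D)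
        = (eLpNorm (W n) 2 (volume.restrict D) ^ 2) ^ (1 / 2 : ℝ) := by
          rw [← ENNReal.rpow_natCast, ← ENNReal.rpow_mul]; norm_num
      _ ≤ A ^ (1 / 2 : ℝ) := ENNReal.rpow_le_rpow this (by norm_num)
  have hA' : A ^ (1 / 2 : ℝ) ≠ ⊤ := ENNReal.rpow_ne_top_of_nonneg (by norm_num) hA
  have hW : ∀ n, MemLp (W n) 2 (volume.restrict D) := fun n =>
    ⟨(h n).locInt_grad.aestronglyMeasurable, (hWle n).trans_lt (lt_top_iff_ne_top.2 hA')⟩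
  obtain ⟨a, ha, hlim⟩ := exists_weak_limit (a := fun n => (hW n).toLp (W n))
    (C := (A ^ (1 / 2 : ℝ)).toReal) (fun n => by
      rw [Lp.norm_toLp]
      exact ENNReal.toReal_mono hA' (hWle n))
  have mu : AEStronglyMeasurable u (volume.restrict D) :=
    aestronglyMeasurable_of_tendsto_ae atTop (fun n => (h n).locInt.aestronglyMeasurable) hw
  have bu : ∀ᵐ x ∂(volume.restrict D), ‖u x‖ ≤ b x := by
    filter_upwards [hw, ae_all_iff.2 hwb] with x h1 h2
    exact le_of_tendsto h1.norm (Eventually.of_forall h2)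
  refine ⟨a, ⟨?_, (L2loc.of_memLp (Lp.memLp a)).locallyIntegrableOn hD, fun φ h1 h2 h3 i => ?_⟩,
    Lp.memLp a, ?_⟩
  · rw [locallyIntegrableOn_iff hD.isLocallyClosed] at hb ⊢
    exact fun k hk hk' => (hb k hk hk').mono'
      (mu.mono_measure (Measure.restrict_mono hk le_rfl))
      (ae_restrict_of_ae_restrict_of_subset hk bu)
  · have e1 : Tendsto (fun n => ∫ x in D, w n x * fderiv ℝ φ x (EuclideanSpace.single i 1)) atTop
        (𝓝 (∫ x in D, u x * fderiv ℝ φ x (EuclideanSpace.single i 1))) := by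
      refine tendsto_integral_of_dominated_convergence _
        (fun n => (integrableOn_mul_fderiv hD (h n).locInt h1 h2 h3 i).aestronglyMeasurable)
        (integrableOn_mul_fderiv hD hb h1 h2 h3 i).norm ?_ ?_
      · intro n
        filter_upwards [hwb n] with x hx
        rw [norm_mul, norm_mul]
        gcongr
        exact hx.trans (le_abs_self _)
      · filter_upwards [hw] with x hx
        exact hx.mul_const _
    let y : E d → E d := fun x => φ x • EuclideanSpace.single i (1 : ℝ)
    have hy : MemLp y 2 (volume.restrict D) := by
      have : Continuous y := h1.continuous.smul continuous_const
      exact (this.memLp_of_hasCompactSupport h2.smul_right).restrict D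
    have hin : ∀ (V : E d → E d) (b : Lp (E d) 2 (volume.restrict D)),
        b =ᵐ[volume.restrict D] V → inner ℝ b (hy.toLp y) = ∫ x in D, V x i * φ x := by
      intro V b hb
      rw [L2.inner_def]
      refine integral_congr_ae ?_
      filter_upwards [hb, hy.coeFn_toLp] with x hx hx'
      rw [hx, hx', inner_smul_right, inner_single_one, mul_comm]
    have e2 := hlim (hy.toLp y)
    rw [hin a a ae_eq_rfl] at e2
    -- The ordinary limit is restricted to the ultrafilter, so that both sides are compared along
    -- the same filter.
    refine tendsto_nhds_unique (e1.mono_left Nat.hyperfilter_le_atTop) ?_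
    simp only [fun n => (h n).integral_eq φ h1 h2 h3 i]
    refine (e2.congr fun n => ?_).neg
    exact hin _ _ (hW n).coeFn_toLp
  · rw [← eLpNorm_two_sq]
    have h1 : eLpNorm a 2 (volume.restrict D) ≤ A ^ (1 / 2 : ℝ) := by
      rw [Lp.norm_def] at ha
      exact (ENNReal.toReal_le_toReal (Lp.eLpNorm_ne_top a) hA').1 ha
    calc eLpNorm a 2 (volume.restrict D) ^ 2 ≤ (A ^ (1 / 2 : ℝ)) ^ 2 := by gcongr
      _ = A := by
        rw [← ENNReal.rpow_natCast, ← ENNReal.rpow_mul]; norm_num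

lemma lintegral_indicator_sq_le (s : Set (E d)) (G : E d → E d) :
    ∫⁻ x in D, ‖s.indicator G x‖ₑ ^ 2 ≤ ∫⁻ x in D, ‖G x‖ₑ ^ 2 := by
  refine lintegral_mono fun x => ?_
  dsimp only
  gcongr
  exact enorm_indicator_le_enorm_self _ _

lemma HasWeakGrad.trunc (hD : IsOpen D) (h : HasWeakGrad D u G) (hu : L2loc D u)
    (hG : L2loc D G) {k : ℕ} (hk : 1 ≤ k) :
    HasWeakGrad D (trunc k u) ({x | |u x| < k}.indicator G) := by
  have hk' : (1 : ℝ) ≤ k := by exact_mod_cast hk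
  have := h.clamp hD hu hG (a := -(k : ℝ)) (b := k) (by linarith)
  rw [trunc_eq]
  simpa only [abs_lt] using this

/-- Lower semicontinuity of the energy with respect to a.e. convergence. -/
lemma hasWeakGrad_of_energy_le (hD : IsOpen D) {w : ℕ → E d → ℝ}
    {W : ℕ → E d → E d} (h : ∀ n, HasWeakGrad D (w n) (W n)) (hw2 : ∀ n, L2loc D (w n))
    (hW2 : ∀ n, L2loc D (W n)) {A : ℝ≥0∞} (hA : A ≠ ⊤)
    (hWA : ∀ n, ∫⁻ x in D, ‖W n x‖ₑ ^ 2 ≤ A) (hu : L2loc D u)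
    (hw : ∀ᵐ x ∂(volume.restrict D), Tendsto (fun n => w n x) atTop (𝓝 (u x))) :
    ∃ G, HasWeakGrad D u G ∧ MemLp G 2 (volume.restrict D) ∧ ∫⁻ x in D, ‖G x‖ₑ ^ 2 ≤ A := by
  -- No common dominating function is available for `w n`, but at a fixed truncation level a
  -- constant dominates. The level is then sent to infinity, with `|u|` as dominating function. The
  -- levels are `k + 1` because the gradient formula for truncations requires a positive level.
  have step : ∀ k : ℕ, ∃ G, HasWeakGrad D (ReflectedDirichlet.trunc (k + 1) u) G ∧
      MemLp G 2 (volume.restrict D) ∧ ∫⁻ x in D, ‖G x‖ₑ ^ 2 ≤ A := by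
    intro k
    refine hasWeakGrad_of_energy_le_of_dominated hD
      (fun n => (h n).trunc hD (hw2 n) (hW2 n) (k := k + 1) (by omega)) hA
      (fun n => (lintegral_indicator_sq_le _ _).trans (hWA n)) (b := fun _ => ((k + 1 : ℕ) : ℝ))
      ((l2loc_const _).locallyIntegrableOn hD)
      (fun n => Eventually.of_forall fun x => abs_trunc_le_natCast _ _ _) ?_
    filter_upwards [hw] with x hx
    exact (tendsto_const_nhds.max hx).min tendsto_const_nhds
  choose V hV1 _ hV3 using step
  refine hasWeakGrad_of_energy_le_of_dominated hD hV1 hA hV3 (hu.norm.locallyIntegrableOn hD)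
    (fun n => Eventually.of_forall fun x => abs_trunc_le _ _ _)
    (Eventually.of_forall fun x => (tendsto_trunc u x).comp (tendsto_add_atTop_nat 1))

/-! ### The Beppo Levi space and the Dirichlet integral -/

lemma mem_BL_of_hasWeakGrad (h : HasWeakGrad D u G) (hu : L2loc D u)
    (hG : MemLp G 2 (volume.restrict D)) : u ∈ BL D := ⟨hu, G, h, hG⟩

lemma l2loc_of_mem_BL (hu : u ∈ BL D) : L2loc D u := hu.1

lemma hasWeakGrad_of_mem_BL (hu : u ∈ BL D) : HasWeakGrad D u (weakGrad D u) := by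
  obtain ⟨-, G, h, -⟩ := hu
  exact h.weakGrad

lemma memLp_weakGrad (hD : IsOpen D) (hu : u ∈ BL D) :
    MemLp (weakGrad D u) 2 (volume.restrict D) := by
  obtain ⟨-, G, h, hG⟩ := hu
  exact (memLp_congr_ae (h.weakGrad_ae hD)).2 hG

lemma l2loc_weakGrad (hD : IsOpen D) (hu : u ∈ BL D) : L2loc D (weakGrad D u) :=
  L2loc.of_memLp (memLp_weakGrad hD hu)

lemma HasWeakGrad.dirichletInt_eq (hD : IsOpen D) (hu : HasWeakGrad D u G)
    (hv : HasWeakGrad D v H) : dirichletInt D u v = ∫ x in D, inner ℝ (G x) (H x) := by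
  refine integral_congr_ae ?_
  filter_upwards [hu.weakGrad_ae hD, hv.weakGrad_ae hD] with x h1 h2
  rw [h1, h2]

lemma HasWeakGrad.dirichletEnergy_eq (hD : IsOpen D) (hu : HasWeakGrad D u G) :
    dirichletEnergy D u = ∫⁻ x in D, ‖G x‖ₑ ^ 2 := by
  refine lintegral_congr_ae ?_
  filter_upwards [hu.weakGrad_ae hD] with x h1
  rw [h1]

lemma integrable_inner_of_memLp {α : Type*} [MeasurableSpace α] {μ : Measure α} {G H : α → E d}
    (hG : MemLp G 2 μ) (hH : MemLp H 2 μ) : Integrable (fun x => inner ℝ (G x) (H x)) μ :=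
  (hG.norm.integrable_mul hH.norm).mono' (hG.1.inner hH.1)
    (Eventually.of_forall fun _ => norm_inner_le_norm _ _)

lemma ofReal_dirichletInt_self (hD : IsOpen D) (hu : u ∈ BL D) :
    ENNReal.ofReal (dirichletInt D u u) = dirichletEnergy D u := by
  have hG := memLp_weakGrad hD hu
  rw [dirichletInt, ofReal_integral_eq_lintegral_ofReal (integrable_inner_of_memLp hG hG)
    (Eventually.of_forall fun x => real_inner_self_nonneg)]
  refine lintegral_congr fun x => ?_
  rw [real_inner_self_eq_norm_sq, ENNReal.ofReal_pow (norm_nonneg _), ofReal_norm]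

lemma dirichletInt_self_nonneg (D : Set (E d)) (u : E d → ℝ) : 0 ≤ dirichletInt D u u :=
  integral_nonneg fun _ => real_inner_self_nonneg

lemma dirichletEnergy_ne_top (hD : IsOpen D) (hu : u ∈ BL D) : dirichletEnergy D u ≠ ⊤ := by
  rw [← ofReal_dirichletInt_self hD hu]; simp

lemma dirichletInt_self_eq_toReal (hD : IsOpen D) (hu : u ∈ BL D) :
    dirichletInt D u u = (dirichletEnergy D u).toReal := by
  rw [← ofReal_dirichletInt_self hD hu, ENNReal.toReal_ofReal (dirichletInt_self_nonneg D u)]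

lemma add_mem_BL (hD : IsOpen D) (hu : u ∈ BL D) (hv : v ∈ BL D) : u + v ∈ BL D :=
  mem_BL_of_hasWeakGrad ((hasWeakGrad_of_mem_BL hu).add hD (hasWeakGrad_of_mem_BL hv))
    ((l2loc_of_mem_BL hu).add (l2loc_of_mem_BL hv))
    ((memLp_weakGrad hD hu).add (memLp_weakGrad hD hv))

lemma sub_mem_BL (hD : IsOpen D) (hu : u ∈ BL D) (hv : v ∈ BL D) : u - v ∈ BL D :=
  mem_BL_of_hasWeakGrad ((hasWeakGrad_of_mem_BL hu).sub hD (hasWeakGrad_of_mem_BL hv))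
    ((l2loc_of_mem_BL hu).sub (l2loc_of_mem_BL hv))
    ((memLp_weakGrad hD hu).sub (memLp_weakGrad hD hv))

lemma smul_mem_BL (hD : IsOpen D) (c : ℝ) (hu : u ∈ BL D) : c • u ∈ BL D :=
  mem_BL_of_hasWeakGrad ((hasWeakGrad_of_mem_BL hu).const_smul c)
    ((l2loc_of_mem_BL hu).const_smul c) ((memLp_weakGrad hD hu).const_smul c)

lemma mem_BL_congr (hu : u ∈ BL D) (h : u =ᵐ[volume.restrict D] v) : v ∈ BL D := by
  obtain ⟨h1, G, h2, h3⟩ := hu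
  exact ⟨L2loc.congr h1 h, G, h2.congr h ae_eq_rfl, h3⟩

lemma dirichletInt_congr (hD : IsOpen D) (hu : u ∈ BL D) (h : u =ᵐ[volume.restrict D] v)
    {w : E d → ℝ} (hw : w ∈ BL D) : dirichletInt D u w = dirichletInt D v w := by
  rw [((hasWeakGrad_of_mem_BL hu).congr h ae_eq_rfl).dirichletInt_eq hD
    (hasWeakGrad_of_mem_BL hw)]
  rfl

lemma dirichletInt_add_left (hD : IsOpen D) (hu : u ∈ BL D) (hv : v ∈ BL D) {w : E d → ℝ}
    (hw : w ∈ BL D) : dirichletInt D (u + v) w = dirichletInt D u w + dirichletInt D v w := by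
  rw [((hasWeakGrad_of_mem_BL hu).add hD (hasWeakGrad_of_mem_BL hv)).dirichletInt_eq hD
    (hasWeakGrad_of_mem_BL hw)]
  simp only [Pi.add_apply, inner_add_left]
  exact integral_add (integrable_inner_of_memLp (memLp_weakGrad hD hu) (memLp_weakGrad hD hw))
    (integrable_inner_of_memLp (memLp_weakGrad hD hv) (memLp_weakGrad hD hw))

lemma dirichletInt_smul_left (hD : IsOpen D) (c : ℝ) (hu : u ∈ BL D) (hv : v ∈ BL D) :
    dirichletInt D (c • u) v = c * dirichletInt D u v := by
  rw [((hasWeakGrad_of_mem_BL hu).const_smul c).dirichletInt_eq hD (hasWeakGrad_of_mem_BL hv)]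
  simp only [Pi.smul_apply, real_inner_smul_left]
  exact integral_const_mul _ _

lemma dirichletInt_comm (D : Set (E d)) (u v : E d → ℝ) :
    dirichletInt D u v = dirichletInt D v u := by
  simp only [dirichletInt, real_inner_comm]

lemma dirichletEnergy_add_le (hD : IsOpen D) (hu : u ∈ BL D) (hv : v ∈ BL D) :
    dirichletEnergy D (u + v) ≤ 2 * dirichletEnergy D u + 2 * dirichletEnergy D v := by
  rw [((hasWeakGrad_of_mem_BL hu).add hD (hasWeakGrad_of_mem_BL hv)).dirichletEnergy_eq hD,
    dirichletEnergy, dirichletEnergy, ← lintegral_const_mul' _ _ (by simp),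
    ← lintegral_const_mul' _ _ (by simp), ← lintegral_add_right']
  · exact lintegral_mono fun x => enorm_add_sq_le _ _
  · exact ((memLp_weakGrad hD hv).1.enorm.pow_const 2).const_mul 2

lemma dirichletEnergy_smul (hD : IsOpen D) (c : ℝ) (hu : u ∈ BL D) :
    dirichletEnergy D (c • u) = ‖c‖ₑ ^ 2 * dirichletEnergy D u := by
  rw [((hasWeakGrad_of_mem_BL hu).const_smul c).dirichletEnergy_eq hD, dirichletEnergy,
    ← lintegral_const_mul' _ _ (by simp)]
  simp only [Pi.smul_apply, enorm_smul, mul_pow]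

lemma dirichletEnergy_sub_comm (hD : IsOpen D) (hu : u ∈ BL D) (hv : v ∈ BL D) :
    dirichletEnergy D (u - v) = dirichletEnergy D (v - u) := by
  have := dirichletEnergy_smul hD (-1) (sub_mem_BL hD hv hu)
  simpa using this

lemma dirichletEnergy_zero (hD : IsOpen D) : dirichletEnergy D (0 : E d → ℝ) = 0 := by
  have := (hasWeakGrad_const hD 0).dirichletEnergy_eq hD
  simp only [Pi.zero_apply, enorm_zero, ne_eq, OfNat.ofNat_ne_zero, not_false_eq_true, zero_pow,
    lintegral_zero] at this
  exact this

/-- A sequence in `BL(D)` with Cauchy gradients converges in energy to its a.e. limit. -/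
lemma tendsto_dirichletEnergy_of_cauchy (hD : IsOpen D) {w : ℕ → E d → ℝ} (hw : ∀ n, w n ∈ BL D)
    (hc : ∀ ε > 0, ∃ N, ∀ n ≥ N, ∀ p ≥ N, dirichletInt D (w n - w p) (w n - w p) < ε)
    {ns : ℕ → ℕ} (hns : Tendsto ns atTop atTop)
    (hlim : ∀ᵐ x ∂(volume.restrict D), Tendsto (fun n => w (ns n) x) atTop (𝓝 (u x)))
    (hu : L2loc D u) :
    u ∈ BL D ∧ Tendsto (fun n => dirichletEnergy D (w n - u)) atTop (𝓝 0) := by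
  -- For fixed `n ≥ N`, let the second index of the Cauchy condition go to infinity along `ns`,
  -- shifted by `J` so that it stays at least `N`. Lower semicontinuity bounds the energy of the
  -- a.e. limit `w n - u`.
  have key : ∀ ε : ℝ, 0 < ε → ∃ N, ∀ n ≥ N, w n - u ∈ BL D ∧
      dirichletEnergy D (w n - u) ≤ ENNReal.ofReal ε := by
    intro ε hε
    obtain ⟨N, hN⟩ := hc ε hε
    obtain ⟨J, hJ⟩ := eventually_atTop.1 (hns.eventually_ge_atTop N)
    refine ⟨N, fun n hn => ?_⟩
    have hb : ∀ j, w n - w (ns (j + J)) ∈ BL D := fun j => sub_mem_BL hD (hw _) (hw _)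
    obtain ⟨G, g1, g2, g3⟩ := hasWeakGrad_of_energy_le hD (u := w n - u)
      (w := fun j => w n - w (ns (j + J)))
      (fun j => hasWeakGrad_of_mem_BL (hb j)) (fun j => l2loc_of_mem_BL (hb j))
      (fun j => l2loc_weakGrad hD (hb j)) (A := ENNReal.ofReal ε) (by simp) (fun j => by
        change dirichletEnergy D _ ≤ _
        rw [← ofReal_dirichletInt_self hD (hb j)]
        exact ENNReal.ofReal_le_ofReal (hN n hn _ (hJ _ (by omega))).le)
      ((l2loc_of_mem_BL (hw n)).sub hu) (by
        filter_upwards [hlim] with x hx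
        exact (hx.comp (tendsto_add_atTop_nat J)).const_sub (w n x))
    refine ⟨mem_BL_of_hasWeakGrad g1 ((l2loc_of_mem_BL (hw n)).sub hu) g2, ?_⟩
    rwa [g1.dirichletEnergy_eq hD]
  constructor
  · obtain ⟨N, hN⟩ := key 1 one_pos
    have := sub_mem_BL hD (hw N) (hN N le_rfl).1
    rwa [sub_sub_cancel] at this
  · rw [ENNReal.tendsto_nhds_zero]
    intro ε hε
    rcases eq_or_ne ε ⊤ with rfl | hεt
    · simp
    · obtain ⟨N, hN⟩ := key ε.toReal (ENNReal.toReal_pos hε.ne' hεt)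
      filter_upwards [eventually_ge_atTop N] with n hn
      have := (hN n hn).2
      rwa [ENNReal.ofReal_toReal hεt] at this

lemma cauchy_of_tendsto_dirichletEnergy (hD : IsOpen D) {w : ℕ → E d → ℝ} (hw : ∀ n, w n ∈ BL D)
    (hu : u ∈ BL D) (h : Tendsto (fun n => dirichletEnergy D (w n - u)) atTop (𝓝 0)) :
    ∀ ε > 0, ∃ N, ∀ n ≥ N, ∀ p ≥ N, dirichletInt D (w n - w p) (w n - w p) < ε := by
  intro ε hε
  -- With `ε / 8` the bound `2a + 2b` gives `ε / 2`, strictly less than `ε`.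
  have h1 := (ENNReal.tendsto_nhds_zero.1 h) (ENNReal.ofReal (ε / 8)) (by simpa using hε)
  obtain ⟨N, hN⟩ := eventually_atTop.1 h1
  refine ⟨N, fun n hn p hp => ?_⟩
  have hb := sub_mem_BL hD (hw n) (hw p)
  have e : w n - w p = (w n - u) + (u - w p) := by abel
  have h2 : dirichletEnergy D (w n - w p) ≤ ENNReal.ofReal (ε / 2) := by
    rw [e]
    refine (dirichletEnergy_add_le hD (sub_mem_BL hD (hw n) hu) (sub_mem_BL hD hu (hw p))).trans ?_
    rw [dirichletEnergy_sub_comm hD hu (hw p)]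
    calc _ ≤ 2 * ENNReal.ofReal (ε / 8) + 2 * ENNReal.ofReal (ε / 8) := by
          gcongr
          exacts [hN n hn, hN p hp]
      _ = ENNReal.ofReal (ε / 2) := by
          rw [← two_mul, ← mul_assoc, show (2 * 2 : ℝ≥0∞) = ENNReal.ofReal 4 by norm_num,
            ← ENNReal.ofReal_mul (by norm_num)]
          congr 1; ring
  rw [dirichletInt_self_eq_toReal hD hb]
  calc _ ≤ (ENNReal.ofReal (ε / 2)).toReal := ENNReal.toReal_mono (by simp) h2
    _ = ε / 2 := ENNReal.toReal_ofReal (by positivity)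
    _ < ε := by linarith

/-! ### The spaces `W^{1,2}` and `W^{1,2}_e` -/

lemma mem_W12_of_contDiff (hD : IsOpen D) {φ : E d → ℝ} (hφ : ContDiff ℝ ∞ φ)
    (hc : HasCompactSupport φ) : φ ∈ W12 D := by
  have hφ1 : ContDiff ℝ 1 φ := hφ.of_le (by simp)
  have h1 : MemLp φ 2 (volume.restrict D) :=
    (hφ.continuous.memLp_of_hasCompactSupport hc).restrict D
  have h2 : HasCompactSupport (gradient φ) := HasCompactSupport.intro hc fun x hx =>
    gradient_eq_zero_of_notMem_tsupport hx
  exact ⟨mem_BL_of_hasWeakGrad (hasWeakGrad_gradient hD hφ1) (L2loc.of_memLp h1)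
    (((continuous_gradient hφ1).memLp_of_hasCompactSupport h2).restrict D), h1⟩

lemma W12_subset_W12e (hD : IsOpen D) : W12 D ⊆ W12e D := fun u hu => by
  refine ⟨fun _ => u, fun _ => hu, ?_, Eventually.of_forall fun x => tendsto_const_nhds⟩
  refine cauchy_of_tendsto_dirichletEnergy hD (fun _ => hu.1) hu.1 ?_
  simp [sub_self, dirichletEnergy_zero hD]

/-- For locally square integrable `u`, lower semicontinuity puts `u` itself in `BL(D)` and upgrades
the Cauchy condition to convergence in energy to `u`. Sums, multiples and contractions are then
handled directly on approximating sequences. -/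
lemma mem_W12e_iff (hD : IsOpen D) (hu : L2loc D u) : u ∈ W12e D ↔ u ∈ BL D ∧
    ∃ w : ℕ → E d → ℝ, (∀ n, w n ∈ W12 D) ∧
      Tendsto (fun n => dirichletEnergy D (w n - u)) atTop (𝓝 0) ∧
      ∀ᵐ x ∂(volume.restrict D), Tendsto (fun n => w n x) atTop (𝓝 (u x)) := by
  constructor
  · rintro ⟨w, w1, w2, w3⟩
    obtain ⟨h1, h2⟩ := tendsto_dirichletEnergy_of_cauchy hD (fun n => (w1 n).1) w2 tendsto_id w3 hu
    exact ⟨h1, w, w1, h2, w3⟩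
  · rintro ⟨h1, w, w1, w2, w3⟩
    exact ⟨w, w1, cauchy_of_tendsto_dirichletEnergy hD (fun n => (w1 n).1) h1 w2, w3⟩

lemma add_mem_W12e (hD : IsOpen D) (hu : L2loc D u) (hv : L2loc D v) (hue : u ∈ W12e D)
    (hve : v ∈ W12e D) : u + v ∈ W12e D := by
  obtain ⟨u1, w, w1, w2, w3⟩ := (mem_W12e_iff hD hu).1 hue
  obtain ⟨v1, z, z1, z2, z3⟩ := (mem_W12e_iff hD hv).1 hve
  refine (mem_W12e_iff hD (hu.add hv)).2 ⟨add_mem_BL hD u1 v1, fun n => w n + z n,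
    fun n => ⟨add_mem_BL hD (w1 n).1 (z1 n).1, (w1 n).2.add (z1 n).2⟩, ?_, ?_⟩
  · have ht : Tendsto (fun n => 2 * dirichletEnergy D (w n - u) + 2 * dirichletEnergy D (z n - v))
        atTop (𝓝 (2 * 0 + 2 * 0)) :=
      (ENNReal.Tendsto.const_mul w2 (Or.inr (by simp))).add
        (ENNReal.Tendsto.const_mul z2 (Or.inr (by simp)))
    simp only [mul_zero, add_zero] at ht
    refine tendsto_of_tendsto_of_tendsto_of_le_of_le tendsto_const_nhds ht (fun _ => zero_le)
      fun n => ?_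
    dsimp only
    rw [add_sub_add_comm]
    exact dirichletEnergy_add_le hD (sub_mem_BL hD (w1 n).1 u1) (sub_mem_BL hD (z1 n).1 v1)
  · filter_upwards [w3, z3] with x h1 h2 using h1.add h2

lemma smul_mem_W12e (hD : IsOpen D) (c : ℝ) (hu : L2loc D u) (hue : u ∈ W12e D) :
    c • u ∈ W12e D := by
  obtain ⟨u1, w, w1, w2, w3⟩ := (mem_W12e_iff hD hu).1 hue
  refine (mem_W12e_iff hD (hu.const_smul c)).2 ⟨smul_mem_BL hD c u1, fun n => c • w n,
    fun n => ⟨smul_mem_BL hD c (w1 n).1, (w1 n).2.const_smul c⟩, ?_, ?_⟩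
  · have ht : Tendsto (fun n => ‖c‖ₑ ^ 2 * dirichletEnergy D (w n - u)) atTop
        (𝓝 (‖c‖ₑ ^ 2 * 0)) := ENNReal.Tendsto.const_mul w2 (Or.inr (by simp))
    rw [mul_zero] at ht
    refine ht.congr fun n => ?_
    rw [← dirichletEnergy_smul hD c (sub_mem_BL hD (w1 n).1 u1), smul_sub]
  · filter_upwards [w3] with x h1 using h1.const_mul c

lemma mem_W12e_congr (hu : u ∈ W12e D) (h : u =ᵐ[volume.restrict D] v) : v ∈ W12e D := by
  obtain ⟨w, w1, w2, w3⟩ := hu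
  refine ⟨w, w1, w2, ?_⟩
  filter_upwards [w3, h] with x h1 h2
  rwa [← h2]

/-! ### Unit contractions -/

lemma unit_contraction_hasWeakGrad (hD : IsOpen D) (hu : u ∈ BL D) :
    HasWeakGrad D (fun x => min (max (u x) 0) 1)
      ({x | 0 < u x ∧ u x < 1}.indicator (weakGrad D u)) :=
  (hasWeakGrad_of_mem_BL hu).clamp hD (l2loc_of_mem_BL hu) (l2loc_weakGrad hD hu) one_pos

lemma abs_unit_contraction_le (t : ℝ) : |min (max t 0) 1| ≤ |t| := by
  rw [abs_of_nonneg (le_min (le_max_right _ _) zero_le_one)]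
  exact (min_le_left _ _).trans (max_le (le_abs_self _) (abs_nonneg _))

lemma memLp_of_hasWeakGrad_of_energy_le (hG : MemLp G 2 (volume.restrict D))
    (h : HasWeakGrad D u H) (hle : ∫⁻ x in D, ‖H x‖ₑ ^ 2 ≤ ∫⁻ x in D, ‖G x‖ₑ ^ 2) :
    MemLp H 2 (volume.restrict D) := by
  refine ⟨h.locInt_grad.aestronglyMeasurable, ?_⟩
  have h1 := hle.trans_lt (lt_top_iff_ne_top.2 (lintegral_sq_ne_top hG))
  rw [← eLpNorm_two_sq] at h1
  exact lt_top_iff_ne_top.2 fun htop => by simp [htop] at h1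

lemma unit_contraction_mem_BL (hD : IsOpen D) (hu : u ∈ BL D) :
    (fun x => min (max (u x) 0) 1) ∈ BL D ∧
      dirichletEnergy D (fun x => min (max (u x) 0) 1) ≤ dirichletEnergy D u := by
  have h := unit_contraction_hasWeakGrad hD hu
  have hle := lintegral_indicator_sq_le (D := D) {x | 0 < u x ∧ u x < 1} (weakGrad D u)
  refine ⟨mem_BL_of_hasWeakGrad h ((l2loc_of_mem_BL hu).of_le h.locInt.aestronglyMeasurable
    (Eventually.of_forall fun x => abs_unit_contraction_le _))
    (memLp_of_hasWeakGrad_of_energy_le (memLp_weakGrad hD hu) h hle), ?_⟩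
  rw [h.dirichletEnergy_eq hD]
  exact hle

lemma unit_contraction_mem_W12 (hD : IsOpen D) (hu : u ∈ W12 D) :
    (fun x => min (max (u x) 0) 1) ∈ W12 D := by
  have h := (unit_contraction_mem_BL hD hu.1).1
  exact ⟨h, hu.2.of_le (hasWeakGrad_of_mem_BL h).locInt.aestronglyMeasurable
    (Eventually.of_forall fun x => abs_unit_contraction_le _)⟩

lemma tendsto_indicator_of_ne {w : ℕ → ℝ} {t : ℝ} (hw : Tendsto w atTop (𝓝 t)) (h0 : t ≠ 0)
    (h1 : t ≠ 1) : ∀ᶠ n in atTop, ((0 < w n ∧ w n < 1) ↔ (0 < t ∧ t < 1)) := by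
  rcases lt_or_gt_of_ne h0 with h0 | h0
  · filter_upwards [hw.eventually_lt_const h0] with n hn
    exact ⟨fun h => absurd h.1 hn.not_gt, fun h => absurd h.1 h0.not_gt⟩
  · rcases lt_or_gt_of_ne h1 with h1 | h1
    · filter_upwards [hw.eventually_const_lt h0, hw.eventually_lt_const h1] with n hn hn'
      exact ⟨fun _ => ⟨h0, h1⟩, fun _ => ⟨hn, hn'⟩⟩
    · filter_upwards [hw.eventually_const_lt h1] with n hn
      exact ⟨fun h => absurd h.2 hn.not_gt, fun h => absurd h.2 h1.not_gt⟩

lemma indicator_sub_indicator {α : Type*} (s t : Set α) (G H : α → E d) (x : α) :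
    s.indicator G x - t.indicator H x =
      s.indicator (G - H) x + (s.indicator H x - t.indicator H x) := by
  by_cases hs : x ∈ s <;> simp [hs]

/-- The unit contraction operates continuously in energy. -/
lemma tendsto_dirichletEnergy_unit_contraction (hD : IsOpen D) {w : ℕ → E d → ℝ}
    (hw : ∀ n, w n ∈ BL D) (hu : u ∈ BL D)
    (ht : Tendsto (fun n => dirichletEnergy D (w n - u)) atTop (𝓝 0))
    (hlim : ∀ᵐ x ∂(volume.restrict D), Tendsto (fun n => w n x) atTop (𝓝 (u x))) :
    Tendsto (fun n => dirichletEnergy D ((fun x => min (max (w n x) 0) 1) -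
      fun x => min (max (u x) 0) 1)) atTop (𝓝 0) := by
  set G := weakGrad D u
  set S : ℕ → Set (E d) := fun n => {x | 0 < w n x ∧ w n x < 1}
  set T : Set (E d) := {x | 0 < u x ∧ u x < 1}
  have hG := memLp_weakGrad hD hu
  have hT := unit_contraction_hasWeakGrad hD hu
  have hS := fun n => unit_contraction_hasWeakGrad hD (hw n)
  have mSG : ∀ n, AEStronglyMeasurable ((S n).indicator G) (volume.restrict D) := fun n => by
    have m := (hasWeakGrad_of_mem_BL (hw n)).locInt.aestronglyMeasurable.aemeasurable
    have mS : NullMeasurableSet (S n) (volume.restrict D) :=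
      (nullMeasurableSet_lt aemeasurable_const m).inter
        (nullMeasurableSet_lt m aemeasurable_const)
    exact hG.1.indicator₀ mS
  have md : ∀ n, AEMeasurable (fun x => ‖(S n).indicator G x - T.indicator G x‖ₑ ^ 2)
      (volume.restrict D) := fun n =>
    ((mSG n).sub hT.locInt_grad.aestronglyMeasurable).enorm.pow_const 2
  -- The gradient difference is `1_{S n} (∇w_n - ∇u) + (1_{S n} - 1_T) ∇u`, and this is its second
  -- part. The indicators converge wherever `u` is neither `0` nor `1`; on those two level sets `∇u
  -- = 0` a.e., so dominated convergence applies.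
  have t2 : Tendsto (fun n => ∫⁻ x in D, ‖(S n).indicator G x - T.indicator G x‖ₑ ^ 2) atTop
      (𝓝 0) := by
    have := tendsto_lintegral_of_dominated_convergence' (μ := volume.restrict D)
      (F := fun n x => ‖(S n).indicator G x - T.indicator G x‖ₑ ^ 2) (f := fun _ => 0)
      (fun x => ‖G x‖ₑ ^ 2) md ?_ (lintegral_sq_ne_top hG) ?_
    · simpa using this
    · refine fun n => Eventually.of_forall fun x => ?_
      dsimp only
      gcongr
      by_cases h1 : x ∈ S n <;> by_cases h2 : x ∈ T <;> simp [h1, h2]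
    · have z0 := (hasWeakGrad_of_mem_BL hu).ae_eq_zero_of_eq hD (l2loc_of_mem_BL hu)
        (l2loc_weakGrad hD hu) 0
      have z1 := (hasWeakGrad_of_mem_BL hu).ae_eq_zero_of_eq hD (l2loc_of_mem_BL hu)
        (l2loc_weakGrad hD hu) 1
      filter_upwards [hlim, z0, z1] with x hx h0 h1
      by_cases hGx : G x = 0
      · have : ∀ s : Set (E d), s.indicator G x = 0 := fun s => by simp [Set.indicator, hGx]
        simp [this]
      · refine tendsto_const_nhds.congr' ?_
        filter_upwards [tendsto_indicator_of_ne hx (fun h => hGx (h0 h)) (fun h => hGx (h1 h))]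
          with n hn
        have : x ∈ S n ↔ x ∈ T := hn
        by_cases hT : x ∈ T
        · simp [hT, this.2 hT]
        · simp [hT, mt this.1 hT]
  have bound : ∀ n, dirichletEnergy D ((fun x => min (max (w n x) 0) 1) -
      fun x => min (max (u x) 0) 1) ≤ 2 * dirichletEnergy D (w n - u) +
      2 * ∫⁻ x in D, ‖(S n).indicator G x - T.indicator G x‖ₑ ^ 2 := fun n => by
    rw [((hS n).sub hD hT).dirichletEnergy_eq hD,
      ((hasWeakGrad_of_mem_BL (hw n)).sub hD (hasWeakGrad_of_mem_BL hu)).dirichletEnergy_eq hD,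
      ← lintegral_const_mul' _ _ (by simp), ← lintegral_const_mul' _ _ (by simp),
      ← lintegral_add_right' _ ((md n).const_mul 2)]
    refine lintegral_mono fun x => ?_
    simp only [Pi.sub_apply]
    rw [indicator_sub_indicator (S n) T]
    refine (enorm_add_sq_le _ _).trans ?_
    gcongr
    exact enorm_indicator_le_enorm_self _ _
  have tt := (ENNReal.Tendsto.const_mul (a := 2) ht (Or.inr (by simp))).add
        (ENNReal.Tendsto.const_mul (a := 2) t2 (Or.inr (by simp)))
  simp only [mul_zero, add_zero] at tt
  exact tendsto_of_tendsto_of_tendsto_of_le_of_le tendsto_const_nhds tt (fun _ => zero_le) bound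

lemma unit_contraction_mem_W12e (hD : IsOpen D) (hu : L2loc D u) (hue : u ∈ W12e D) :
    (fun x => min (max (u x) 0) 1) ∈ W12e D := by
  obtain ⟨u1, w, w1, w2, w3⟩ := (mem_W12e_iff hD hu).1 hue
  have h := (unit_contraction_mem_BL hD u1).1
  refine (mem_W12e_iff hD (l2loc_of_mem_BL h)).2 ⟨h, fun n x => min (max (w n x) 0) 1,
    fun n => unit_contraction_mem_W12 hD (w1 n),
    tendsto_dirichletEnergy_unit_contraction hD (fun n => (w1 n).1) u1 w2 w3, ?_⟩
  filter_upwards [w3] with x hx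
  exact (hx.max tendsto_const_nhds).min tendsto_const_nhds

/-- `W^{1,2}_e(D)` is closed under convergence in energy and almost everywhere. -/
lemma mem_W12e_of_tendsto (hD : IsOpen D) {w : ℕ → E d → ℝ} (hw : ∀ n, w n ∈ W12e D)
    (hw2 : ∀ n, L2loc D (w n)) (hu : u ∈ BL D)
    (ht : Tendsto (fun n => dirichletEnergy D (w n - u)) atTop (𝓝 0))
    (hlim : ∀ᵐ x ∂(volume.restrict D), Tendsto (fun n => w n x) atTop (𝓝 (u x))) :
    u ∈ W12e D := by
  -- For a finite measure with the same null sets, a.e. convergence implies convergence in measure.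
  -- This gives a quantitative choice of `z n ∈ W^{1,2}(D)` close to `w n` both in energy and in
  -- measure; a.e. convergence of the diagonal sequence is recovered along a subsequence.
  let ν := (volume.restrict D).toFinite
  have hν : ae ν = ae (volume.restrict D) := ae_toFinite
  have hνac : ν ≪ volume.restrict D := Measure.ae_le_iff_absolutelyContinuous.1 hν.le
  have hbl : ∀ n, w n ∈ BL D := fun n => ((mem_W12e_iff hD (hw2 n)).1 (hw n)).1
  have ex : ∀ n : ℕ, ∃ z ∈ W12 D, dirichletEnergy D (z - w n) ≤ ENNReal.ofReal (1 / (n + 1)) ∧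
      ν {x | 1 / ((n : ℝ) + 1) ≤ ‖z x - w n x‖} ≤ ENNReal.ofReal (1 / (n + 1)) := by
    intro n
    obtain ⟨-, a, a1, a2, a3⟩ := (mem_W12e_iff hD (hw2 n)).1 (hw n)
    have hm : TendstoInMeasure ν a atTop (w n) := tendstoInMeasure_of_tendsto_ae
      (fun j => (a1 j).2.1.mono_ac hνac) (by rw [hν]; exact a3)
    rw [tendstoInMeasure_iff_norm] at hm
    have hpos : (0 : ℝ≥0∞) < ENNReal.ofReal (1 / (n + 1)) := by
      rw [ENNReal.ofReal_pos]; positivity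
    obtain ⟨j, h1, h2⟩ := ((ENNReal.tendsto_nhds_zero.1 a2 _ hpos).and
      (ENNReal.tendsto_nhds_zero.1 (hm (1 / ((n : ℝ) + 1)) (by positivity)) _ hpos)).exists
    exact ⟨a j, a1 j, h1, h2⟩
  choose z z1 z2 z3 using ex
  have hreal : Tendsto (fun n : ℕ => 1 / ((n : ℝ) + 1)) atTop (𝓝 0) :=
    tendsto_one_div_add_atTop_nhds_zero_nat
  have hzero : Tendsto (fun n : ℕ => ENNReal.ofReal (1 / ((n : ℝ) + 1))) atTop (𝓝 0) := by
    simpa using ENNReal.tendsto_ofReal hreal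
  have hmeas : TendstoInMeasure ν (fun n x => z n x - w n x) atTop (fun _ => 0) := by
    rw [tendstoInMeasure_iff_norm]
    intro ε hε
    refine tendsto_of_tendsto_of_tendsto_of_le_of_le' tendsto_const_nhds hzero
      (Eventually.of_forall fun _ => zero_le) ?_
    filter_upwards [hreal.eventually_lt_const hε] with n hn
    refine (measure_mono fun x hx => ?_).trans (z3 n)
    simp only [Set.mem_ofPred_eq, sub_zero] at hx ⊢
    exact hn.le.trans hx
  obtain ⟨ns, hns, hae⟩ := hmeas.exists_seq_tendsto_ae
  rw [hν] at hae
  refine (mem_W12e_iff hD (l2loc_of_mem_BL hu)).2 ⟨hu, fun j => z (ns j), fun j => z1 _, ?_, ?_⟩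
  · have tt := (ENNReal.Tendsto.const_mul (a := 2) hzero (Or.inr (by simp))).add
      (ENNReal.Tendsto.const_mul (a := 2) ht (Or.inr (by simp)))
    simp only [mul_zero, add_zero] at tt
    refine tendsto_of_tendsto_of_tendsto_of_le_of_le tendsto_const_nhds
      (tt.comp hns.tendsto_atTop) (fun _ => zero_le) fun j => ?_
    have e : z (ns j) - u = (z (ns j) - w (ns j)) + (w (ns j) - u) := by abel
    simp only [Function.comp_apply]
    rw [e]
    refine (dirichletEnergy_add_le hD (sub_mem_BL hD (z1 _).1 (hbl _))
      (sub_mem_BL hD (hbl _) hu)).trans ?_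
    gcongr
    exact z2 _
  · filter_upwards [hae, hlim] with x h1 h2
    simpa using h1.add (h2.comp hns.tendsto_atTop)

end

section

variable {d : ℕ} {D : Set (E d)} {u v : E d → ℝ} {m : E d → ℝ}

/-! ### The weighted measure -/

lemma ae_wMeasure (hD : IsOpen D) (hc : ContinuousOn m (closure D))
    (hp : ∀ x ∈ closure D, 0 < m x) : ae (wMeasure D m) = ae (volume.restrict D) := by
  have hm : AEMeasurable (fun x => ENNReal.ofReal (m x)) (volume.restrict D) :=
    ((hc.mono subset_closure).aemeasurable hD.measurableSet).ennreal_ofReal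
  ext s
  change (∀ᵐ x ∂(wMeasure D m), x ∈ s) ↔ ∀ᵐ x ∂(volume.restrict D), x ∈ s
  rw [wMeasure, ae_withDensity_iff' hm]
  refine eventually_congr ?_
  filter_upwards [ae_restrict_mem hD.measurableSet] with x hx
  have : ENNReal.ofReal (m x) ≠ 0 := (ENNReal.ofReal_pos.2 (hp x (subset_closure hx))).ne'
  simp [this]

lemma wMeasure_le (hD : IsOpen D) {C : ℝ} (hb : ∀ x ∈ closure D, m x ≤ C) :
    wMeasure D m ≤ ENNReal.ofReal C • volume.restrict D := by
  rw [← withDensity_const]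
  refine withDensity_mono ?_
  filter_upwards [ae_restrict_mem hD.measurableSet] with x hx
  exact ENNReal.ofReal_le_ofReal (hb x (subset_closure hx))

lemma isFiniteMeasureOnCompacts_wMeasure (hD : IsOpen D) (hb : ∃ C : ℝ, ∀ x ∈ closure D, m x ≤ C) :
    IsFiniteMeasureOnCompacts (wMeasure D m) := by
  obtain ⟨C, hC⟩ := hb
  refine ⟨fun K hK => ((wMeasure_le hD hC) K).trans_lt ?_⟩
  rw [Measure.smul_apply, smul_eq_mul]
  exact ENNReal.mul_lt_top (by simp)
    ((Measure.restrict_apply_le D K).trans_lt hK.measure_lt_top)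

lemma memLp_wMeasure (hD : IsOpen D) (hb : ∃ C : ℝ, ∀ x ∈ closure D, m x ≤ C)
    (hu : MemLp u 2 (volume.restrict D)) : MemLp u 2 (wMeasure D m) := by
  obtain ⟨C, hC⟩ := hb
  exact hu.of_measure_le_smul (by simp) (wMeasure_le hD hC)

/-- A continuous positive density has a positive minimum on each compact subset of `D`, so Lebesgue
measure there is at most a multiple of the weighted measure. -/
lemma l2loc_of_memLp_wMeasure (hc : ContinuousOn m (closure D))
    (hp : ∀ x ∈ closure D, 0 < m x) (hu : MemLp u 2 (wMeasure D m)) : L2loc D u := by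
  intro K hKD hK
  rcases K.eq_empty_or_nonempty with rfl | hne
  · simp
  obtain ⟨x₀, hx₀, hmin⟩ := hK.exists_isMinOn hne (hc.mono (hKD.trans subset_closure))
  have hm0 : 0 < m x₀ := hp x₀ (subset_closure (hKD hx₀))
  have hne0 : ENNReal.ofReal (m x₀) ≠ 0 := (ENNReal.ofReal_pos.2 hm0).ne'
  refine hu.of_measure_le_smul (c := (ENNReal.ofReal (m x₀))⁻¹) (by simpa using hm0) ?_
  refine Measure.le_iff.2 fun s hs => ?_
  rw [Measure.smul_apply, smul_eq_mul, Measure.restrict_apply hs, wMeasure,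
    withDensity_apply _ hs, Measure.restrict_restrict hs]
  calc volume (s ∩ K) = (ENNReal.ofReal (m x₀))⁻¹ * (ENNReal.ofReal (m x₀) * volume (s ∩ K)) := by
        rw [← mul_assoc, ENNReal.inv_mul_cancel hne0 (by simp), one_mul]
    _ = (ENNReal.ofReal (m x₀))⁻¹ * ∫⁻ x in s ∩ K, ENNReal.ofReal (m x₀) := by
        rw [setLIntegral_const]
    _ ≤ (ENNReal.ofReal (m x₀))⁻¹ * ∫⁻ x in s ∩ K, ENNReal.ofReal (m x) := by
        refine mul_le_mul' le_rfl ?_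
        exact setLIntegral_mono' (hs.inter hK.measurableSet) fun x hx =>
          ENNReal.ofReal_le_ofReal (hmin hx.2)
    _ ≤ _ := mul_le_mul' le_rfl (lintegral_mono_set (Set.inter_subset_inter_right s hKD))

/-! ### A criterion for Dirichlet forms -/

lemma norm_toLp_sq {α : Type*} [MeasurableSpace α] {μ : Measure α} {f : α → ℝ}
    (hf : MemLp f 2 μ) : ‖hf.toLp f‖ ^ 2 = ∫ x, f x ^ 2 ∂μ := by
  rw [← real_inner_self_eq_norm_sq, L2.inner_def]
  refine integral_congr_ae ?_
  filter_upwards [hf.coeFn_toLp] with x hx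
  rw [hx, real_inner_self_eq_norm_sq, Real.norm_eq_abs, sq_abs]

/-- Completeness of `L²` for sequences of functions. -/
lemma exists_memLp_limit {α : Type*} [MeasurableSpace α] {μ : Measure α} {w : ℕ → α → ℝ}
    (hw : ∀ n, MemLp (w n) 2 μ)
    (hc : ∀ ε > 0, ∃ N, ∀ n ≥ N, ∀ p ≥ N, ∫ x, (w n x - w p x) ^ 2 ∂μ < ε) :
    ∃ u, MemLp u 2 μ ∧ Tendsto (fun n => ∫ x, (w n x - u x) ^ 2 ∂μ) atTop (𝓝 0) ∧
      ∃ ns : ℕ → ℕ, StrictMono ns ∧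
        ∀ᵐ x ∂μ, Tendsto (fun j => w (ns j) x) atTop (𝓝 (u x)) := by
  have hcs : CauchySeq fun n => (hw n).toLp (w n) := by
    refine Metric.cauchySeq_iff.2 fun ε hε => ?_
    obtain ⟨N, hN⟩ := hc (ε ^ 2) (by positivity)
    refine ⟨N, fun n hn p hp => ?_⟩
    rw [dist_eq_norm, ← MemLp.toLp_sub]
    refine lt_of_pow_lt_pow_left₀ 2 hε.le ?_
    rw [norm_toLp_sq]
    exact hN n hn p hp
  obtain ⟨U, hU⟩ := cauchySeq_tendsto_of_complete hcs
  have hUm := Lp.memLp U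
  refine ⟨U, hUm, ?_, ?_⟩
  · have h1 : Tendsto (fun n => ‖(hw n).toLp (w n) - U‖ ^ 2) atTop (𝓝 0) := by
      have := (tendsto_iff_norm_sub_tendsto_zero.1 hU).pow 2
      simpa using this
    refine h1.congr fun n => ?_
    conv_lhs => rw [← Lp.toLp_coeFn U hUm, ← MemLp.toLp_sub]
    exact norm_toLp_sq _
  · obtain ⟨ns, hns, hae⟩ := (tendstoInMeasure_of_tendsto_Lp hU).exists_seq_tendsto_ae
    refine ⟨ns, hns, ?_⟩
    filter_upwards [hae, ae_all_iff.2 fun n => (hw n).coeFn_toLp] with x h1 h2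
    simpa only [h2] using h1

/-- A class `F` of functions in `BL(D) ∩ L²(D;m)` is the domain of a Dirichlet form as soon as it is a
linear space of a.e. classes that contains the test functions, is stable under the unit contraction
and is closed under convergence in energy and almost everywhere. -/
lemma isDirichletForm_halfD (hD : IsOpen D) (hc : ContinuousOn m (closure D))
    (hb : ∃ C : ℝ, ∀ x ∈ closure D, m x ≤ C) (hp : ∀ x ∈ closure D, 0 < m x)
    {F : Set (E d → ℝ)} (hBL : ∀ u ∈ F, u ∈ BL D) (hL2 : ∀ u ∈ F, MemLp u 2 (wMeasure D m))
    (hae : ∀ u ∈ F, ∀ v, u =ᵐ[volume.restrict D] v → v ∈ F)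
    (hadd : ∀ u ∈ F, ∀ v ∈ F, u + v ∈ F) (hsmul : ∀ c : ℝ, ∀ u ∈ F, c • u ∈ F)
    (hsmooth : ∀ φ : E d → ℝ, ContDiff ℝ ∞ φ → HasCompactSupport φ → φ ∈ F)
    (hunit : ∀ u ∈ F, (fun x => min (max (u x) 0) 1) ∈ F)
    (hclosed : ∀ (w : ℕ → E d → ℝ) (u : E d → ℝ), (∀ n, w n ∈ F) → u ∈ BL D →
      MemLp u 2 (wMeasure D m) → Tendsto (fun n => dirichletEnergy D (w n - u)) atTop (𝓝 0) →
      (∀ᵐ x ∂(volume.restrict D), Tendsto (fun n => w n x) atTop (𝓝 (u x))) → u ∈ F) :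
    IsDirichletForm (wMeasure D m) (halfD D F) where
  memLp := hL2
  ae_mem u hu v huv := hae u hu v (by rwa [Filter.EventuallyEq, ae_wMeasure hD hc hp] at huv)
  ae_form u hu v huv w hw := by
    rw [Filter.EventuallyEq, ae_wMeasure hD hc hp] at huv
    simp only [halfD]
    rw [dirichletInt_congr hD (hBL u hu) huv (hBL w hw)]
  add_mem := hadd
  smul_mem := hsmul
  dense u hu ε hε := by
    have := isFiniteMeasureOnCompacts_wMeasure hD hb
    obtain ⟨r, hr0, hrε⟩ := ENNReal.lt_iff_exists_real_btwn.1 hε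
    have hr : 0 < r := ENNReal.ofReal_pos.1 hrε.1
    obtain ⟨g, g1, g2, g3⟩ := hu.exist_eLpNorm_sub_le (by simp) one_le_two hr
    exact ⟨g, hsmooth g g2 g1, g3.trans_lt hrε.2⟩
  form_add u hu v hv w hw := by
    simp only [halfD]
    rw [dirichletInt_add_left hD (hBL u hu) (hBL v hv) (hBL w hw)]
    ring
  form_smul c u hu v hv := by
    simp only [halfD]
    rw [dirichletInt_smul_left hD c (hBL u hu) (hBL v hv)]
    ring
  symm u _ v _ := by
    simp only [halfD]
    rw [dirichletInt_comm]
  nonneg u _ := mul_nonneg (by norm_num) (dirichletInt_self_nonneg D u)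
  closed w hw hcau := by
    simp only [halfD] at hw hcau ⊢
    have nn : ∀ f : E d → ℝ, 0 ≤ ∫ x, f x ^ 2 ∂(wMeasure D m) := fun f =>
      integral_nonneg fun x => sq_nonneg _
    obtain ⟨u, u1, u2, ns, u3, u4⟩ := exists_memLp_limit (fun n => hL2 _ (hw n)) (fun ε hε => by
      obtain ⟨N, hN⟩ := hcau ε hε
      refine ⟨N, fun n hn p hp => ?_⟩
      linarith [hN n hn p hp, dirichletInt_self_nonneg D (w n - w p)])
    rw [ae_wMeasure hD hc hp] at u4
    obtain ⟨v1, v2⟩ := tendsto_dirichletEnergy_of_cauchy hD (fun n => hBL _ (hw n)) (fun ε hε => by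
      -- The halved tolerance compensates the factor `½` in the form; the `L²` term is nonnegative
      -- and can be dropped.
      obtain ⟨N, hN⟩ := hcau (ε / 2) (by positivity)
      refine ⟨N, fun n hn p hp => ?_⟩
      linarith [hN n hn p hp, nn fun x => w n x - w p x]) u3.tendsto_atTop u4
      (l2loc_of_memLp_wMeasure hc hp u1)
    -- Almost everywhere convergence holds only along `ns`, which suffices for membership;
    -- convergence in the form norm holds along the full sequence.
    have huF : u ∈ F := hclosed (fun j => w (ns j)) u (fun j => hw _) v1 u1
      (v2.comp u3.tendsto_atTop) u4
    refine ⟨u, huF, ?_⟩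
    have h1 : Tendsto (fun n => dirichletInt D (w n - u) (w n - u)) atTop (𝓝 0) := by
      have := (ENNReal.tendsto_toReal ENNReal.zero_ne_top).comp v2
      refine this.congr fun n => ?_
      exact (dirichletInt_self_eq_toReal hD (sub_mem_BL hD (hBL _ (hw n)) v1)).symm
    have h2 := (h1.const_mul (1 / 2)).add u2
    rwa [mul_zero, add_zero] at h2
  markov u hu := by
    refine ⟨hunit u hu, ?_⟩
    have h := unit_contraction_mem_BL hD (hBL u hu)
    simp only [halfD]
    rw [dirichletInt_self_eq_toReal hD h.1, dirichletInt_self_eq_toReal hD (hBL u hu)]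
    have := ENNReal.toReal_mono (dirichletEnergy_ne_top hD (hBL u hu)) h.2
    linarith

/-! ### The two Dirichlet forms on `L²(D;m)`. -/

lemma unit_contraction_memLp_wMeasure (hu : MemLp u 2 (wMeasure D m)) :
    MemLp (fun x => min (max (u x) 0) 1) 2 (wMeasure D m) := by
  refine hu.of_le ?_ (Eventually.of_forall fun x => abs_unit_contraction_le _)
  exact (by fun_prop : Continuous fun t : ℝ => min (max t 0) 1).comp_aestronglyMeasurable hu.1

lemma isDirichletForm_starForm (hD : IsOpen D) (hc : ContinuousOn m (closure D))
    (hb : ∃ C : ℝ, ∀ x ∈ closure D, m x ≤ C) (hp : ∀ x ∈ closure D, 0 < m x) :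
    IsDirichletForm (wMeasure D m) (starForm D m) := by
  refine isDirichletForm_halfD hD hc hb hp (fun u hu => hu.1) (fun u hu => hu.2) ?_ ?_ ?_ ?_ ?_ ?_
  · rintro u ⟨h1, h2⟩ v huv
    refine ⟨mem_BL_congr h1 huv, (memLp_congr_ae ?_).1 h2⟩
    rwa [Filter.EventuallyEq, ae_wMeasure hD hc hp]
  · rintro u ⟨h1, h2⟩ v ⟨h3, h4⟩
    exact ⟨add_mem_BL hD h1 h3, h2.add h4⟩
  · rintro c u ⟨h1, h2⟩
    exact ⟨smul_mem_BL hD c h1, h2.const_smul c⟩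
  · intro φ h1 h2
    have := mem_W12_of_contDiff hD h1 h2
    exact ⟨this.1, memLp_wMeasure hD hb this.2⟩
  · rintro u ⟨h1, h2⟩
    exact ⟨(unit_contraction_mem_BL hD h1).1, unit_contraction_memLp_wMeasure h2⟩
  · intro w u _ h1 h2 _ _
    exact ⟨h1, h2⟩

lemma isDirichletForm_timeChangedForm (hD : IsOpen D) (hc : ContinuousOn m (closure D))
    (hb : ∃ C : ℝ, ∀ x ∈ closure D, m x ≤ C) (hp : ∀ x ∈ closure D, 0 < m x) :
    IsDirichletForm (wMeasure D m) (timeChangedForm D m) := by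
  have hl : ∀ {u : E d → ℝ}, MemLp u 2 (wMeasure D m) → L2loc D u := fun h =>
    l2loc_of_memLp_wMeasure hc hp h
  refine isDirichletForm_halfD hD hc hb hp
    (fun u hu => ((mem_W12e_iff hD (hl hu.2)).1 hu.1).1) (fun u hu => hu.2) ?_ ?_ ?_ ?_ ?_ ?_
  · rintro u ⟨h1, h2⟩ v huv
    refine ⟨mem_W12e_congr h1 huv, (memLp_congr_ae ?_).1 h2⟩
    rwa [Filter.EventuallyEq, ae_wMeasure hD hc hp]
  · rintro u ⟨h1, h2⟩ v ⟨h3, h4⟩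
    exact ⟨add_mem_W12e hD (hl h2) (hl h4) h1 h3, h2.add h4⟩
  · rintro c u ⟨h1, h2⟩
    exact ⟨smul_mem_W12e hD c (hl h2) h1, h2.const_smul c⟩
  · intro φ h1 h2
    have := mem_W12_of_contDiff hD h1 h2
    exact ⟨W12_subset_W12e hD this, memLp_wMeasure hD hb this.2⟩
  · rintro u ⟨h1, h2⟩
    exact ⟨unit_contraction_mem_W12e hD (hl h2) h1, unit_contraction_memLp_wMeasure h2⟩
  · intro w u hw h1 h2 h3 h4
    exact ⟨mem_W12e_of_tendsto hD (fun n => (hw n).1) (fun n => hl (hw n).2) h1 h3 h4, h2⟩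

/-! ### The reflected Dirichlet space -/

lemma trunc_mem_BL (hD : IsOpen D) (hu : u ∈ BL D) {k : ℕ} (hk : 1 ≤ k) :
    trunc k u ∈ BL D ∧ dirichletEnergy D (trunc k u) ≤ dirichletEnergy D u := by
  have h := (hasWeakGrad_of_mem_BL hu).trunc hD (l2loc_of_mem_BL hu) (l2loc_weakGrad hD hu) hk
  have hle := lintegral_indicator_sq_le (D := D) {x | |u x| < k} (weakGrad D u)
  refine ⟨mem_BL_of_hasWeakGrad h ((l2loc_of_mem_BL hu).of_le h.locInt.aestronglyMeasurable
    (Eventually.of_forall fun x => abs_trunc_le _ _ _))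
    (memLp_of_hasWeakGrad_of_energy_le (memLp_weakGrad hD hu) h hle), ?_⟩
  rw [h.dirichletEnergy_eq hD]
  exact hle

/-- Bounded functions in `BL(D)` are locally in `W^{1,2}(D)`, up to the boundary. -/
lemma exists_W12_eq_on_bounded (hD : IsOpen D) (hu : u ∈ BL D) {C : ℝ} (hC : ∀ x, |u x| ≤ C)
    {U : Set (E d)} (hU : Bornology.IsBounded U) : ∃ g ∈ W12 D, ∀ x ∈ U, u x = g x := by
  -- The cutoff lives on `ℝ^d` and may charge the boundary of `D`, near which a `BL(D)` function
  -- need not be square integrable. The bound on `u` is what makes `χ u` and `u ∇χ` square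
  -- integrable.
  obtain ⟨χ, c1, c2, -, c4, c5⟩ := exists_cutoff isOpen_univ hU.isCompact_closure
    (Set.subset_univ (closure U))
  have h := (hasWeakGrad_of_mem_BL hu).smooth_mul hD c1
  have hgc : Continuous (gradient χ) := continuous_gradient (c1.of_le (by simp))
  have hgcs : HasCompactSupport (gradient χ) :=
    HasCompactSupport.intro c2 fun x hx => gradient_eq_zero_of_notMem_tsupport hx
  have mu := (hasWeakGrad_of_mem_BL hu).locInt.aestronglyMeasurable
  have hG := memLp_weakGrad hD hu
  have h2 : MemLp (fun x => χ x * u x) 2 (volume.restrict D) := by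
    refine (((c1.continuous.memLp_of_hasCompactSupport c2).restrict D).const_smul C).of_le
      h.locInt.aestronglyMeasurable (Eventually.of_forall fun x => ?_)
    simp only [Pi.smul_apply, norm_smul, norm_mul]
    rw [mul_comm]
    gcongr
    exact (hC x).trans (le_abs_self _)
  have h3 : MemLp (fun x => χ x • weakGrad D u x + u x • gradient χ x) 2 (volume.restrict D) := by
    refine MemLp.add (f := fun x => χ x • weakGrad D u x) (g := fun x => u x • gradient χ x) ?_ ?_
    · refine hG.of_le (c1.continuous.aestronglyMeasurable.smul hG.1)
        (Eventually.of_forall fun x => ?_)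
      rw [norm_smul]
      exact mul_le_of_le_one_left (norm_nonneg _) (by
        rw [Real.norm_of_nonneg (c4 x).1]; exact (c4 x).2)
    · refine (((hgc.memLp_of_hasCompactSupport hgcs).restrict D).const_smul C).of_le
        (mu.smul hgc.aestronglyMeasurable) (Eventually.of_forall fun x => ?_)
      simp only [Pi.smul_apply, norm_smul]
      gcongr
      exact (hC x).trans (le_abs_self _)
  refine ⟨fun x => χ x * u x, ⟨mem_BL_of_hasWeakGrad h (L2loc.of_memLp h2) h3, h2⟩,
    fun x hx => ?_⟩
  simp [(c5 x (subset_closure hx)).1]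

/-- A function that agrees with elements of `BL(D)` on bounded sets has a distributional gradient. -/
lemma exists_hasWeakGrad_of_local (hD : IsOpen D) {f : E d → ℝ} {g : ℕ → E d → ℝ}
    (hg : ∀ n, g n ∈ BL D)
    (hfg : ∀ n : ℕ, f =ᵐ[volume.restrict (Metric.ball 0 (n : ℝ) ∩ D)] g n) :
    ∃ G, HasWeakGrad D f G := by
  let V : ℕ → Set (E d) := fun n => Metric.ball 0 (n : ℝ) ∩ D
  have hV : ∀ n, IsOpen (V n) := fun n => Metric.isOpen_ball.inter hD
  have hVmono : Monotone V := fun i j hij =>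
    Set.inter_subset_inter_left D (Metric.ball_subset_ball (by exact_mod_cast hij))
  have hw : ∀ n, HasWeakGrad (V n) f (weakGrad D (g n)) := fun n =>
    ((hasWeakGrad_of_mem_BL (hg n)).mono hD Set.inter_subset_right).congr (hfg n).symm ae_eq_rfl
  have hagree : ∀ i j, i ≤ j → ∀ᵐ x, x ∈ V i → weakGrad D (g j) x = weakGrad D (g i) x := by
    intro i j hij
    have := ((hw j).mono (hV j) (hVmono hij)).ae_unique (hV i) (hw i)
    exact (ae_restrict_iff' (hV i).measurableSet).1 this
  -- A ball containing `x`, chosen pointwise; the gradient of `f` at `x` is read off from the local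
  -- representative on that ball. Different choices agree a.e. by uniqueness, and as there are
  -- countably many indices one null set serves all.
  let N : E d → ℕ := fun x => ⌊‖x‖⌋₊ + 1
  have hN : ∀ x ∈ D, x ∈ V (N x) := fun x hx => by
    refine ⟨?_, hx⟩
    rw [mem_ball_zero_iff]
    simpa [N] using Nat.lt_floor_add_one ‖x‖
  refine ⟨fun x => weakGrad D (g (N x)) x, hasWeakGrad_of_iUnion hD hV
    (directed_of_isDirected_le hVmono) ?_ fun n => (hw n).congr ae_eq_rfl ?_⟩
  · ext x
    simp only [Set.mem_iUnion]
    exact ⟨fun ⟨n, hn⟩ => hn.2, fun hx => ⟨N x, hN x hx⟩⟩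
  · have hall : ∀ᵐ x, ∀ i j, i ≤ j → x ∈ V i → weakGrad D (g j) x = weakGrad D (g i) x := by
      rw [ae_all_iff]; intro i
      rw [ae_all_iff]; intro j
      by_cases hij : i ≤ j
      · filter_upwards [hagree i j hij] with x hx _ using hx
      · exact Eventually.of_forall fun x h => absurd h hij
    filter_upwards [ae_restrict_of_ae hall, ae_restrict_mem (hV n).measurableSet] with x hx hxn
    rcases le_total n (N x) with hle | hle
    · exact (hx n (N x) hle hxn).symm
    · exact hx (N x) n hle (hN x hxn.2)

/-- The truncation level in `truncGrad` varies with the point, so the gradient formula is first made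
to hold at all levels outside one null set. The level strictly exceeds `|u x|`, so the indicator in
the formula equals `1`. -/
lemma truncGrad_ae (hD : IsOpen D) (hu : u ∈ BL D) :
    truncGrad D u =ᵐ[volume.restrict D] weakGrad D u := by
  have h : ∀ k : ℕ, ∀ᵐ x ∂(volume.restrict D),
      weakGrad D (trunc (k + 1) u) x = {x | |u x| < (k + 1 : ℕ)}.indicator (weakGrad D u) x :=
    fun k => ((hasWeakGrad_of_mem_BL hu).trunc hD (l2loc_of_mem_BL hu) (l2loc_weakGrad hD hu)
      (by omega)).weakGrad_ae hD
  filter_upwards [ae_all_iff.2 h] with x hx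
  rw [truncGrad, hx]
  refine Set.indicator_of_mem ?_ _
  change |u x| < _
  push_cast
  exact Nat.lt_floor_add_one _

/-- Truncation produces a bounded function without increasing the energy, and bounded functions of
`BL(D)` coincide on bounded sets with elements of `W^{1,2}(D)`. -/
lemma BL_subset_reflectedForm_dom (hD : IsOpen D) {F : Set (E d → ℝ)} (hF : W12 D ⊆ F) :
    BL D ⊆ (reflectedForm D F).dom := by
  intro f hf
  refine ⟨fun k hk U hU hUb => ?_, ?_⟩
  · obtain ⟨g, hg, hgU⟩ := exists_W12_eq_on_bounded hD (trunc_mem_BL hD hf hk).1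
      (abs_trunc_le_natCast k f) (hUb.subset (Set.inter_subset_left (t := D)))
    refine ⟨g, hF hg, ?_⟩
    filter_upwards [ae_restrict_mem (hU.inter hD).measurableSet] with x hx using hgU x hx
  · refine lt_of_le_of_lt (iSup₂_le fun k hk => (trunc_mem_BL hD hf hk).2) ?_
    exact lt_top_iff_ne_top.2 (dirichletEnergy_ne_top hD hf)

/-- Local agreement with `BL(D)` gives each truncation a distributional gradient, and the supremum
bounds all their energies. The bound yields first local square integrability of `f`, then its
gradient as a weak limit, with `|f|` dominating the truncations. -/
lemma reflectedForm_dom_subset_BL (hD : IsOpen D) {F : Set (E d → ℝ)} (hF : F ⊆ BL D) :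
    (reflectedForm D F).dom ⊆ BL D := by
  rintro f ⟨h1, h2⟩
  set A := ⨆ k : ℕ, ⨆ _ : 1 ≤ k, dirichletEnergy D (trunc k f)
  have hex : ∀ k, 1 ≤ k → ∃ G, HasWeakGrad D (trunc k f) G := fun k hk => by
    have := fun n : ℕ => h1 k hk (Metric.ball 0 (n : ℝ)) Metric.isOpen_ball Metric.isBounded_ball
    choose g g1 g2 using this
    exact exists_hasWeakGrad_of_local hD (fun n => hF (g1 n)) g2
  have hW : ∀ k, 1 ≤ k → HasWeakGrad D (trunc k f) (weakGrad D (trunc k f)) := fun k hk =>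
    (hex k hk).choose_spec.weakGrad
  have hWA : ∀ k, 1 ≤ k → ∫⁻ x in D, ‖weakGrad D (trunc k f) x‖ₑ ^ 2 ≤ A := fun k hk =>
    le_iSup₂ (f := fun (k : ℕ) (_ : 1 ≤ k) => dirichletEnergy D (trunc k f)) k hk
  have hW2 : ∀ k, 1 ≤ k → L2loc D (weakGrad D (trunc k f)) := fun k hk => by
    refine L2loc.of_memLp ⟨(hW k hk).locInt_grad.aestronglyMeasurable, ?_⟩
    have h3 := (hWA k hk).trans_lt h2
    rw [← eLpNorm_two_sq] at h3
    exact lt_top_iff_ne_top.2 fun htop => by simp [htop] at h3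
  have hlim : ∀ x, Tendsto (fun k => trunc (k + 1) f x) atTop (𝓝 (f x)) := fun x =>
    (tendsto_trunc f x).comp (tendsto_add_atTop_nat 1)
  have hfm : AEStronglyMeasurable f (volume.restrict D) :=
    aestronglyMeasurable_of_tendsto_ae atTop
      (fun k => (hW (k + 1) (by omega)).locInt.aestronglyMeasurable) (Eventually.of_forall hlim)
  have hf2 : L2loc D f := l2loc_of_trunc hD hfm hW hW2 h2.ne hWA
  obtain ⟨G, g1, g2, -⟩ := hasWeakGrad_of_energy_le_of_dominated hD
    (fun k => hW (k + 1) (by omega)) h2.ne (fun k => hWA (k + 1) (by omega))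
    (hf2.norm.locallyIntegrableOn hD)
    (fun k => Eventually.of_forall fun x => abs_trunc_le _ _ _) (Eventually.of_forall hlim)
  exact mem_BL_of_hasWeakGrad g1 hf2 g2

lemma reflectedForm_form_eq (hD : IsOpen D) (F : Set (E d → ℝ)) (hu : u ∈ BL D) (hv : v ∈ BL D) :
    (reflectedForm D F).form u v = (1 / 2) * dirichletInt D u v := by
  simp only [reflectedForm, dirichletInt]
  congr 1
  refine integral_congr_ae ?_
  filter_upwards [truncGrad_ae hD hu, truncGrad_ae hD hv] with x h1 h2
  rw [h1, h2]

/-- The reflected Dirichlet space of the time-changed form is `BL(D)`. -/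
lemma reflectedForm_timeChangedForm_dom (hD : IsOpen D) (hc : ContinuousOn m (closure D))
    (hb : ∃ C : ℝ, ∀ x ∈ closure D, m x ≤ C) (hp : ∀ x ∈ closure D, 0 < m x) :
    (reflectedForm D (timeChangedForm D m).dom).dom = BL D := by
  have h1 : W12 D ⊆ (timeChangedForm D m).dom := fun u hu =>
    ⟨W12_subset_W12e hD hu, memLp_wMeasure hD hb hu.2⟩
  have h2 : (timeChangedForm D m).dom ⊆ BL D := fun u hu =>
    ((mem_W12e_iff hD (l2loc_of_memLp_wMeasure hc hp hu.2)).1 hu.1).1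
  exact (reflectedForm_dom_subset_BL hD h2).antisymm (BL_subset_reflectedForm_dom hD h1)

end

end ReflectedDirichlet

/-! ### Assembly of the main theorem. -/

theorem mainTheorem5 (d : ℕ) (hd : 1 ≤ d) (D : Set (ReflectedDirichlet.E d))
    (hD : ReflectedDirichlet.IsRegularDomain D)
    (m : ReflectedDirichlet.E d → ℝ) (hm_cont : ContinuousOn m (closure D))
    (hm_bdd : ∃ C : ℝ, ∀ x ∈ closure D, m x ≤ C) (hm_pos : ∀ x ∈ closure D, 0 < m x) :
    ReflectedDirichlet.IsDirichletForm (ReflectedDirichlet.wMeasure D m)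
        (ReflectedDirichlet.timeChangedForm D m) ∧
    ReflectedDirichlet.IsDirichletForm (ReflectedDirichlet.wMeasure D m)
        (ReflectedDirichlet.starForm D m) ∧
    (ReflectedDirichlet.activeReflectedForm D m
        (ReflectedDirichlet.timeChangedForm D m).dom).Same
      (ReflectedDirichlet.starForm D m) ∧
    (ReflectedDirichlet.reflectedForm D (ReflectedDirichlet.timeChangedForm D m).dom).Same
      (ReflectedDirichlet.halfD D (ReflectedDirichlet.BL D)) := by
  have hDo := hD.isOpen
  have hdom := ReflectedDirichlet.reflectedForm_timeChangedForm_dom hDo hm_cont hm_bdd hm_pos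
  refine ⟨ReflectedDirichlet.isDirichletForm_timeChangedForm hDo hm_cont hm_bdd hm_pos,
    ReflectedDirichlet.isDirichletForm_starForm hDo hm_cont hm_bdd hm_pos, ⟨?_, ?_⟩, hdom, ?_⟩
  · simp only [ReflectedDirichlet.activeReflectedForm, hdom]
    rfl
  · rintro u ⟨hu, -⟩ v ⟨hv, -⟩
    rw [hdom] at hu hv
    exact ReflectedDirichlet.reflectedForm_form_eq hDo (ReflectedDirichlet.timeChangedForm D m).dom
      hu hv
  · intro u hu v hv
    rw [hdom] at hu hv
    exact ReflectedDirichlet.reflectedForm_form_eq hDo _ hu hv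

end
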